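/- Consider a slotted single-server first-come-first-served queue that starts empty. In each slot $t=0,1,2,\dots$ a packet arrives at the beginning of the slot with probability $\lambda>0$, independently over slots. The service times (in slots) are i.i.d. positive integers distributed as $S$ and independent of the arrivals, with $\mathbb{E}[S]=1/\mu$ and $\mathbb{E}[S^2]<\infty$; services are performed in consecutive slots and finish at the end of a slot. Put $\rho=\lambda/\mu$, assume $\rho<1$, and let $L_S(x)=\mathbb{E}[x^S]$. Let $Y_i$ be the arrival slot of packet $i$. The age $A(t)$ at the beginning of slot $t$ starts from an arbitrary value $A(0)\in\{0,1,2,\dots\}$ and satisfies $A(t+1)=\min\{t-Y_i,A(t)\}+1$ if packet $i$ is served at time $t$ (its service finishes at the end of slot $t$), and $A(t+1)=A(t)+1$ if no packet is served at time $t$. Define $$A^{\mathrm p}=\limsup_{T\to\infty}\frac{\sum_{t=1}^{T}A(t)\mathbf 1\{A(t+1)\le A(t)\}}{\sum_{t=1}^{T}\mathbf 1\{A(t+1)\le A(t)\}},\qquad A^{\mathrm{ave}}=\limsup_{T\to\infty}\frac1T\sum_{t=1}^{T}A(t).$$ (a) If the service of a packet can begin at the earliest in the slot following its arrival slot, then almost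 surely $$A^{\mathrm p}=\frac1\lambda+\frac1\mu+\frac{\lambda\mathbb{E}[S^2]-\rho}{2(1-\rho)},\qquad A^{\mathrm{ave}}=1+\frac1\mu+\frac{(1-\lambda)(1-\rho)}{\lambda L_S(1-\lambda)}+\frac{\lambda\mathbb{E}[S^2]-\rho}{2(1-\rho)}.$$ (b) If the service of a packet can begin already in its arrival slot, then almost surely $A^{\mathrm p}$ and $A^{\mathrm{ave}}$ are both exactly $1$ less than these values. -/

import Mathlib

open MeasureTheory ProbabilityTheory Filter

/-! A slotted single-server FCFS queue along one sample path. Slots are numbered `0, 1, 2, …`;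
`arr t` says whether a packet arrives (is generated) at the beginning of slot `t`, and `s n` is
the service time, in slots, of the `n`-th packet (`n = 0, 1, …` in order of arrival). The queue
starts empty. -/

/-- Generation time `Y n` of packet `n`: the `n`-th slot with an arrival. -/
noncomputable def genTime (arr : ℕ → Bool) (n : ℕ) : ℕ :=
  Nat.nth (fun t => arr t = true) n

/-- First slot of the service of packet `n`. Service is first come first serve and
work-conserving: the packet starts as soon as it is available and its predecessor is finished.
A packet generated in slot `Y` is available for service from slot `Y + d` on: `d = 0` means that
service can begin in the arrival slot itself, `d = 1` that it can begin in the next slot. -/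
noncomputable def startSlot (d : ℕ) (arr : ℕ → Bool) (s : ℕ → ℕ) : ℕ → ℕ
  | 0 => genTime arr 0 + d
  | n + 1 => max (genTime arr (n + 1) + d) (startSlot d arr s n + s n)

/-- Packet `n` is served at time `t`: it occupies the `s n` slots from `startSlot n` on, and its
service finishes at the end of slot `t`. -/
def ServedAt (d : ℕ) (arr : ℕ → Bool) (s : ℕ → ℕ) (n t : ℕ) : Prop :=
  startSlot d arr s n + s n = t + 1

open Classical in
/-- The age `A t` at the beginning of slot `t`, with initial value `a₀`:
`A (t + 1) = min (t - Y i) (A t) + 1` if packet `i` is served at time `t`, and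
`A (t + 1) = A t + 1` if no packet is. (When service times are positive, at most one packet is
served at a given time `t`, and `Y i ≤ t`.) -/
noncomputable def age (d : ℕ) (a₀ : ℕ) (arr : ℕ → Bool) (s : ℕ → ℕ) : ℕ → ℕ
  | 0 => a₀
  | t + 1 =>
    if h : ∃ i, ServedAt d arr s i t then
      min (t - genTime arr (Nat.find h)) (age d a₀ arr s t) + 1
    else age d a₀ arr s t + 1

/-- The peak age of an age process `A`: the upper limit of the average of `A t` over the slots
`t = 1, …, T` in which there is a useful delivery, i.e. `A (t + 1) ≤ A t`. -/
noncomputable def peakAge (A : ℕ → ℕ) : EReal :=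
  limsup (fun T : ℕ =>
    (((∑ t ∈ Finset.Icc 1 T, if A (t + 1) ≤ A t then (A t : ℝ) else 0) /
      (∑ t ∈ Finset.Icc 1 T, if A (t + 1) ≤ A t then (1 : ℝ) else 0) : ℝ) : EReal)) atTop

/-- The average age of an age process `A`: the upper limit of its time averages. -/
noncomputable def averageAge (A : ℕ → ℕ) : EReal :=
  limsup (fun T : ℕ => ((1 / (T : ℝ) * ∑ t ∈ Finset.Icc 1 T, (A t : ℝ) : ℝ) : EReal)) atTop

/-- The hypotheses of the discrete-time Ber/G/1 model: `B t` is the indicator of an arrival in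
slot `t` and `S n` is the service time of packet `n`. Arrivals are i.i.d. Bernoulli with parameter
`lam`, service times are i.i.d. positive integers, and the two families are independent. -/
structure IsBerG1 {Ω : Type*} [MeasurableSpace Ω] (P : Measure Ω) (lam : ℝ)
    (B : ℕ → Ω → Bool) (S : ℕ → Ω → ℕ) : Prop where
  measurable_arrival : ∀ t, Measurable (B t)
  measurable_service : ∀ n, Measurable (S n)
  prob_arrival : ∀ t, P.real {ω | B t ω = true} = lam
  indep_arrival : iIndepFun B P
  identDistrib_service : ∀ n, IdentDistrib (S n) (S 0) P P
  indep_service : iIndepFun S P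
  service_pos : ∀ᵐ ω ∂P, 1 ≤ S 0 ω
  indep_arrival_service : IndepFun (fun ω t => B t ω) (fun ω n => S n ω) P

/-- The probability generating function `x ↦ E[x ^ S]` of a random variable with values in `ℕ`. -/
noncomputable def probGenFun {Ω : Type*} [MeasurableSpace Ω] (P : Measure Ω) (S : Ω → ℕ)
    (x : ℝ) : ℝ :=
  ∫ ω, x ^ S ω ∂P

/-! Along a sample path the age is a sawtooth. Service is first come first served, so after the
first delivery each new packet is fresher than its predecessor, and between the deliveries of
packets `n` and `n + 1` the age in slot `t` is `t - Y n` (`age_of_between`). Write `X` for the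
number of slots between these two arrivals, and `T = d + W + S - 1` for the system time, with
waiting time `W` and service time `S`. The peak at the delivery of packet `n + 1` is `X + T`, and
the area under the tooth is `X ^ 2 / 2 + X / 2 + X * T` plus a telescoping term
(`sum_peaks_finishSlot`, `sum_age_finishSlot`). Deliveries occur at rate `lam`, so with long-run
means `E` the two ages are `1 / lam + E[S] + E[W] + d - 1` and `1 / lam + E[S] + lam * E[X W] + d -
1` (`ages_eq_of_averages`). The waiting times do not depend on `d`, which gives the difference of
one slot between the two service conventions.

It remains to find the long-run averages of `W` and of `X W`, where `W` follows the Lindley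
recursion driven by i.i.d. pairs of a service time and a geometric gap. A packet that finds the
queue empty starts the recursion afresh, so the cycles between such packets are i.i.d.
(`measure_regeneration`, `map_iterate_eq_iidMeasure`). The strong law for cycle sums then makes time
averages converge to means under the normalised occupation measure of a cycle
(`tendsto_waiting_average`). This measure is finite and has a first moment by a Foster-Lyapunov
argument (`lintegral_cycleOccupation_le`).

The stationary means come from three equations: the stationary mean increment of a test function
vanishes, because its sum over a cycle telescopes to zero (`integral_increment_eq_zero`). Put `q = 1
- lam`. Since the gap is geometric, the test functions `w`, `w ^ 2` and `q ^ w` have explicit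
drifts. They yield, in turn, `E[q ^ (W + S)] = 1 - ρ`, the mean of `W`, and `E[(W + S) q ^ (W +
S)]`; these determine `E[X W]` (`stationaryWaiting_means`). -/

/-! ### Regeneration of i.i.d. sequences at stopping times. -/

/-- The law of an i.i.d. sequence with marginal `ν`. -/
noncomputable abbrev iidMeasure {E : Type*} [MeasurableSpace E] (ν : Measure E) : Measure (ℕ → E) :=
  Measure.infinitePi (fun _ : ℕ => ν)

/-- The first `k` terms of `u`, followed by the sequence `v`. -/
def seqConcat {E : Type*} (k : ℕ) (u v : ℕ → E) (i : ℕ) : E := if i < k then u i else v (i - k)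

lemma seqConcat_of_lt {E : Type*} {k i : ℕ} (h : i < k) (u v : ℕ → E) : seqConcat k u v i = u i := if_pos h

lemma seqConcat_add {E : Type*} (k i : ℕ) (u v : ℕ → E) : seqConcat k u v (k + i) = v i := by
  simp [seqConcat]

lemma measurable_seqConcat {E : Type*} [MeasurableSpace E] (k : ℕ) :
    Measurable (fun p : (ℕ → E) × (ℕ → E) => seqConcat k p.1 p.2) := by
  refine measurable_pi_iff.2 fun i => ?_
  unfold seqConcat
  split_ifs <;> fun_prop

/-- A box condition on the glued sequence splits into one on the coordinates of `u` below `k` and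
one, reindexed by `k`, on `v`; the product of the two measures is the same product of marginals.
This allows the future from `k` on to be replaced by an independent copy. -/
lemma map_seqConcat {E : Type*} [MeasurableSpace E] (ν : Measure E) [IsProbabilityMeasure ν] (k : ℕ) :
    ((iidMeasure ν).prod (iidMeasure ν)).map (fun p => seqConcat k p.1 p.2) = iidMeasure ν := by
  refine Measure.eq_infinitePi _ fun s t ht => ?_
  rw [Measure.map_apply (measurable_seqConcat k) (.pi s.countable_toSet fun i _ => ht i)]
  have hset : (fun p : (ℕ → E) × (ℕ → E) => seqConcat k p.1 p.2) ⁻¹' (s : Set ℕ).pi t =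
      ((s.filter (· < k) : Finset ℕ) : Set ℕ).pi t ×ˢ
        (((s.filter (¬ · < k)).image (· - k) : Finset ℕ) : Set ℕ).pi (fun i => t (i + k)) := by
    ext ⟨u, v⟩
    simp only [Set.mem_preimage, Set.mem_pi, Finset.mem_coe, Set.mem_prod, Finset.mem_filter,
      Finset.mem_image, seqConcat]
    constructor
    · refine fun h => ⟨fun i hi => by simpa [hi.2] using h i hi.1, ?_⟩
      rintro _ ⟨i, hi, rfl⟩
      have := h i hi.1
      rw [if_neg hi.2] at this
      rwa [Nat.sub_add_cancel (not_lt.1 hi.2)]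
    · rintro ⟨h₁, h₂⟩ i hi
      split_ifs with hik
      · exact h₁ i ⟨hi, hik⟩
      · have := h₂ (i - k) ⟨i, ⟨hi, hik⟩, rfl⟩
        rwa [Nat.sub_add_cancel (not_lt.1 hik)] at this
  rw [hset, Measure.prod_prod, Measure.infinitePi_pi _ (fun i _ => ht i),
    Measure.infinitePi_pi _ (fun i _ => ht (i + k)), Finset.prod_image]
  · rw [← Finset.prod_filter_mul_prod_filter_not s (· < k)]
    congr 1
    refine Finset.prod_congr rfl fun i hi => ?_
    rw [Nat.sub_add_cancel (not_lt.1 (Finset.mem_filter.1 hi).2)]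
  · intro i hi j hj hij
    simp only [Finset.coe_filter, Set.mem_ofPred_eq] at hi hj
    simp only at hij
    omega

/-- The sequence `u` after its first `k` terms. -/
def seqShift {E : Type*} (k : ℕ) (u : ℕ → E) (i : ℕ) : E := u (k + i)

lemma measurable_seqShift_random {E : Type*} [MeasurableSpace E] {τ : (ℕ → E) → ℕ} (hτ : Measurable τ) :
    Measurable (fun u => seqShift (τ u) u) := by
  refine measurable_pi_iff.2 fun i => ?_
  have : Measurable (fun p : ℕ × (ℕ → E) => p.2 (p.1 + i)) :=
    measurable_from_prod_countable_right fun n => measurable_pi_apply (n + i)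
  exact this.comp (hτ.prodMk measurable_id)

lemma seqShift_seqConcat {E : Type*} (k : ℕ) (u v : ℕ → E) : seqShift k (seqConcat k u v) = v :=
  funext fun i => seqConcat_add k i u v

/-- At an almost surely positive time `τ` such that `τ` and `C` depend only on the terms before
`τ`, an i.i.d. sequence starts afresh, independently of `C`. -/
theorem measure_regeneration {E : Type*} [MeasurableSpace E] {γ : Type*} [MeasurableSpace γ] (ν : Measure E)
    [IsProbabilityMeasure ν] {τ : (ℕ → E) → ℕ} {C : (ℕ → E) → γ} (hτ : Measurable τ)
    (hC : Measurable C) (hpos : ∀ᵐ u ∂iidMeasure ν, 0 < τ u)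
    (hdep : ∀ k, 0 < k → ∀ u v : ℕ → E, (∀ i < k, u i = v i) → τ u = k → τ v = k ∧ C u = C v)
    {A : Set γ} (hA : MeasurableSet A) {D : Set (ℕ → E)} (hD : MeasurableSet D) :
    iidMeasure ν {u | C u ∈ A ∧ seqShift (τ u) u ∈ D} =
      iidMeasure ν {u | C u ∈ A} * iidMeasure ν D := by
  have hmA : MeasurableSet {u | C u ∈ A} := hC hA
  have hmτ : ∀ k, MeasurableSet {u | τ u = k} := fun k => hτ (measurableSet_singleton k)
  have hmD : MeasurableSet {u | seqShift (τ u) u ∈ D} := measurable_seqShift_random hτ hD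
  have hsum : ∀ s : Set (ℕ → E), MeasurableSet s →
      iidMeasure ν s = ∑' k, iidMeasure ν (s ∩ {u | τ u = k}) := by
    intro s hs
    rw [← measure_iUnion (fun i j hij => Set.disjoint_left.2 fun u hu hu' =>
      hij (hu.2.symm.trans hu'.2)) (fun k => hs.inter (hmτ k))]
    congr 1
    ext u
    simp
  change iidMeasure ν ({u | C u ∈ A} ∩ {u | seqShift (τ u) u ∈ D}) = _
  rw [hsum _ (hmA.inter hmD), hsum _ hmA, ← ENNReal.tsum_mul_right]
  refine tsum_congr fun k => ?_
  -- The value `0` is reserved for a time that never comes. It says nothing about the past and is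
  -- discarded as a null event.
  rcases Nat.eq_zero_or_pos k with rfl | hk
  · have h0 : iidMeasure ν {u | τ u = 0} = 0 := by
      refine measure_mono_null (fun u hu => ?_) hpos
      simp only [Set.mem_compl_iff, Set.mem_ofPred_eq] at hu ⊢
      omega
    rw [measure_mono_null Set.inter_subset_right h0, measure_mono_null Set.inter_subset_right h0,
      zero_mul]
  · have hmeas : MeasurableSet (({u | C u ∈ A} ∩ {u | seqShift (τ u) u ∈ D}) ∩ {u | τ u = k}) :=
      (hmA.inter hmD).inter (hmτ k)
    have hfact : ∀ u v, (τ (seqConcat k u v) = k ↔ τ u = k) ∧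
        (τ u = k → C (seqConcat k u v) = C u) := by
      intro u v
      refine ⟨⟨fun h => (hdep k hk _ u (fun i hi => seqConcat_of_lt hi u v) h).1,
        fun h => (hdep k hk u _ (fun i hi => (seqConcat_of_lt hi u v).symm) h).1⟩,
        fun h => (hdep k hk u _ (fun i hi => (seqConcat_of_lt hi u v).symm) h).2.symm⟩
    -- Glue `u` up to `k` to an independent `v`: on `τ = k` the time and `C` see only `u`, while the
    -- shifted sequence is exactly `v`.
    calc iidMeasure ν (({u | C u ∈ A} ∩ {u | seqShift (τ u) u ∈ D}) ∩ {u | τ u = k})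
        = ((iidMeasure ν).prod (iidMeasure ν)) (({u | C u ∈ A} ∩ {u | τ u = k}) ×ˢ D) := by
          conv_lhs => rw [← map_seqConcat ν k]
          rw [Measure.map_apply (measurable_seqConcat k) hmeas]
          congr 1
          ext ⟨u, v⟩
          simp only [Set.mem_preimage, Set.mem_inter_iff, Set.mem_ofPred_eq, Set.mem_prod]
          constructor
          · rintro ⟨⟨h₁, h₂⟩, h₃⟩
            rw [h₃, seqShift_seqConcat] at h₂
            have h₄ := (hfact u v).1.1 h₃
            rw [(hfact u v).2 h₄] at h₁
            exact ⟨⟨h₁, h₄⟩, h₂⟩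
          · rintro ⟨⟨h₁, h₂⟩, h₃⟩
            have h₄ := (hfact u v).1.2 h₂
            rw [h₄, (hfact u v).2 h₂, seqShift_seqConcat]
            exact ⟨⟨h₁, h₃⟩, rfl⟩
      _ = _ := by rw [Measure.prod_prod]

/-- This is regeneration with a trivial observable `C`. -/
lemma measurePreserving_regeneration {E : Type*} [MeasurableSpace E] (ν : Measure E)
    [IsProbabilityMeasure ν] {τ : (ℕ → E) → ℕ} (hτ : Measurable τ)
    (hpos : ∀ᵐ u ∂iidMeasure ν, 0 < τ u)
    (hdep : ∀ k, 0 < k → ∀ u v : ℕ → E, (∀ i < k, u i = v i) → τ u = k → τ v = k) :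
    MeasurePreserving (fun u => seqShift (τ u) u) (iidMeasure ν) (iidMeasure ν) := by
  refine ⟨measurable_seqShift_random hτ, Measure.ext fun D hD => ?_⟩
  rw [Measure.map_apply (measurable_seqShift_random hτ) hD]
  have := measure_regeneration (γ := Unit) ν (C := fun _ => ()) hτ measurable_const hpos
    (fun k hk u v h h' => ⟨hdep k hk u v h h', rfl⟩) MeasurableSet.univ hD
  simp only [Set.mem_univ, true_and, Set.ofPred_true, measure_univ, one_mul] at this
  exact this

/-- If `θ` preserves the measure and is independent of `C`, then `C`, `C ∘ θ`, `C ∘ θ ∘ θ`, … are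
independent and identically distributed. -/
theorem map_iterate_eq_iidMeasure {Ω γ : Type*} [MeasurableSpace Ω] [MeasurableSpace γ]
    {P : Measure Ω} [IsProbabilityMeasure P] {θ : Ω → Ω} {C : Ω → γ} (hC : Measurable C)
    (hθ : MeasurePreserving θ P P)
    (hind : ∀ A D, MeasurableSet A → MeasurableSet D →
      P {ω | C ω ∈ A ∧ θ ω ∈ D} = P {ω | C ω ∈ A} * P D) :
    P.map (fun ω n => C (θ^[n] ω)) = iidMeasure (P.map C) := by
  have : IsProbabilityMeasure (P.map C) := Measure.isProbabilityMeasure_map hC.aemeasurable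
  have hmeas : ∀ n, Measurable (fun ω => C (θ^[n] ω)) := fun n =>
    hC.comp (hθ.measurable.iterate n)
  have hrange : ∀ (n : ℕ) (t : ℕ → Set γ), (∀ i, MeasurableSet (t i)) →
      P {ω | ∀ i < n, C (θ^[i] ω) ∈ t i} = ∏ i ∈ Finset.range n, P.map C (t i) := by
    intro n
    induction n with
    | zero => intro t _; simp
    | succ n ih =>
      intro t ht
      have hD : MeasurableSet {ω | ∀ i < n, C (θ^[i] ω) ∈ t (i + 1)} := by
        have : {ω | ∀ i < n, C (θ^[i] ω) ∈ t (i + 1)} =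
            ⋂ i, ⋂ (_ : i < n), {ω | C (θ^[i] ω) ∈ t (i + 1)} := by ext; simp
        rw [this]
        exact .iInter fun i => .iInter fun _ => hmeas i (ht _)
      have hset : {ω | ∀ i < n + 1, C (θ^[i] ω) ∈ t i} =
          {ω | C ω ∈ t 0 ∧ θ ω ∈ {ω | ∀ i < n, C (θ^[i] ω) ∈ t (i + 1)}} := by
        ext ω
        simp only [Set.mem_ofPred_eq, ← Function.iterate_succ_apply]
        constructor
        · exact fun h => ⟨h 0 n.succ_pos, fun i hi => h (i + 1) (by omega)⟩
        · rintro ⟨h₀, h⟩ (_ | i) hi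
          · exact h₀
          · exact h i (by omega)
      rw [hset, hind _ _ (ht 0) hD, ih _ (fun i => ht (i + 1)), Finset.prod_range_succ',
        Measure.map_apply hC (ht 0), mul_comm]
      rfl
  refine Measure.eq_infinitePi _ fun s t ht => ?_
  classical
  rw [Measure.map_apply (measurable_pi_iff.2 hmeas) (.pi s.countable_toSet fun i _ => ht i)]
  -- An arbitrary finite set of coordinates is enlarged to an initial segment, with unconstrained
  -- factors of mass one.
  obtain ⟨n, hn⟩ := s.exists_nat_subset_range
  have := hrange n (fun i => if i ∈ s then t i else Set.univ)
    (fun i => by split_ifs <;> simp [ht])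
  have hprod : ∏ i ∈ s, P.map C (t i) =
      ∏ i ∈ Finset.range n, P.map C (if i ∈ s then t i else Set.univ) := by
    rw [← Finset.prod_subset hn (f := fun i => P.map C (if i ∈ s then t i else Set.univ))]
    · exact Finset.prod_congr rfl fun i hi => by simp [hi]
    · intro i _ hi
      simp [hi, measure_univ]
  rw [hprod, ← this]
  congr 1
  ext ω
  simp only [Set.mem_preimage, Set.mem_pi, Finset.mem_coe, Set.mem_ofPred_eq]
  constructor
  · intro h i _
    split_ifs with hi
    · exact h i hi
    · trivial
  · intro h i hi
    simpa [hi] using h i (Finset.mem_range.1 (hn hi))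

/-! ### The strong law and limits of averages along a subsequence. -/

/-- The strong law of large numbers for functions of the terms of an i.i.d. sequence. -/
lemma strong_law_iidMeasure {E : Type*} [MeasurableSpace E] (ν : Measure E)
    [IsProbabilityMeasure ν] {f : E → ℝ} (hfm : Measurable f) (hf : Integrable f ν) :
    ∀ᵐ u ∂iidMeasure ν, Tendsto (fun n : ℕ => (∑ i ∈ Finset.range n, f (u i)) / n) atTop
      (nhds (∫ x, f x ∂ν)) := by
  have hmp := fun i : ℕ => measurePreserving_eval_infinitePi (fun _ : ℕ => ν) i
  have hind : iIndepFun (fun (i : ℕ) (u : ℕ → E) => f (u i)) (iidMeasure ν) :=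
    iIndepFun_infinitePi (P := fun _ : ℕ => ν) (X := fun _ x => f x) (fun _ => hfm)
  have hlaw : ∀ i : ℕ, (iidMeasure ν).map (fun u => f (u i)) = ν.map f := by
    intro i
    have := Measure.map_map (μ := iidMeasure ν) hfm (hmp i).measurable
    rw [(hmp i).map_eq] at this
    exact this.symm
  have h := strong_law_ae_real (μ := iidMeasure ν) (fun i u => f (u i))
    ((hmp 0).integrable_comp_of_integrable hf) (fun i j hij => hind.indepFun hij)
    (fun i => ⟨(hfm.comp (measurable_pi_apply i)).aemeasurable,
      (hfm.comp (measurable_pi_apply 0)).aemeasurable, by rw [hlaw, hlaw]⟩)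
  have hint : ∫ u, f (u 0) ∂iidMeasure ν = ∫ x, f x ∂ν := by
    have := integral_map (μ := iidMeasure ν) (hmp 0).measurable.aemeasurable
      (hfm.aestronglyMeasurable (μ := (iidMeasure ν).map _))
    rw [(hmp 0).map_eq] at this
    exact this.symm
  rw [hint] at h
  exact h

lemma tendsto_succ_div_nat : Tendsto (fun n : ℕ => ((n : ℝ) + 1) / n) atTop (nhds 1) := by
  have h := (tendsto_const_nhds (x := (1 : ℝ))).add
    (tendsto_const_div_atTop_nhds_zero_nat (1 : ℝ))
  rw [add_zero] at h
  refine h.congr' ?_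
  filter_upwards [eventually_gt_atTop 0] with n hn
  have : (n : ℝ) ≠ 0 := by positivity
  field_simp

/-- If `a` is monotone and `a (c j) / j → α`, where `c j / j → β > 0`, then `a n / n → α / β`. -/
theorem tendsto_div_of_monotone_of_tendsto_comp {a : ℕ → ℝ} (ha : Monotone a) {c : ℕ → ℕ}
    {α β : ℝ} (hβ : 0 < β) (hc : Tendsto (fun j : ℕ => (c j : ℝ) / j) atTop (nhds β))
    (hac : Tendsto (fun j : ℕ => a (c j) / j) atTop (nhds α)) :
    Tendsto (fun n : ℕ => a n / n) atTop (nhds (α / β)) := by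
  have hcpos : ∀ᶠ j : ℕ in atTop, 0 < (c j : ℝ) / j := hc.eventually (lt_mem_nhds hβ)
  -- For each ratio `b > 1` a subsequence is needed that eventually grows by a factor of at most `b`
  -- per step. Since `c (j + 1) / c j → 1`, the sequence `c` itself serves for all `b`.
  refine tendsto_div_of_monotone_of_exists_subseq_tendsto_div a _ ha fun b hb => ⟨c, ?_, ?_, ?_⟩
  · have hratio : Tendsto (fun j : ℕ => ((c (j + 1) : ℝ) / (j + 1 : ℕ)) / ((c j : ℝ) / j) *
        (((j : ℝ) + 1) / j)) atTop (nhds 1) := by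
      have := ((hc.comp (tendsto_add_atTop_nat 1)).div hc hβ.ne').mul tendsto_succ_div_nat
      rwa [div_self hβ.ne', one_mul] at this
    filter_upwards [hratio.eventually (gt_mem_nhds hb), hcpos, eventually_gt_atTop 0]
      with j hj hcj hj0
    have hj0' : (0 : ℝ) < j := by positivity
    have hc0 : 0 < (c j : ℝ) := by
      have := mul_pos hcj hj0'
      rwa [div_mul_cancel₀ _ hj0'.ne'] at this
    have heq : ((c (j + 1) : ℝ) / (j + 1 : ℕ)) / ((c j : ℝ) / j) * (((j : ℝ) + 1) / j) =
        c (j + 1) / c j := by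
      push_cast
      field_simp
    rw [heq, div_lt_iff₀ hc0] at hj
    exact hj.le
  · have : Tendsto (fun j : ℕ => (c j : ℝ) / j * j) atTop atTop :=
      hc.pos_mul_atTop hβ tendsto_natCast_atTop_atTop
    refine tendsto_natCast_atTop_iff.1 (this.congr' ?_)
    filter_upwards [eventually_gt_atTop 0] with j hj
    have : (j : ℝ) ≠ 0 := by positivity
    field_simp
  · refine (hac.div hc hβ.ne').congr' ?_
    filter_upwards [eventually_gt_atTop 0] with j hj
    have : (j : ℝ) ≠ 0 := by positivity
    simp only [Pi.div_apply]
    field_simp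

/-! ### The Lindley recursion and its cycles. -/

/-- One step of the Lindley recursion. The pair `z` consists of a service time and of the number
of slots between the next two arrival slots. -/
def lindley (w : ℕ) (z : ℕ × ℕ) : ℕ := w + z.1 - (z.2 + 1)

/-- The waiting times of the packets of an initially empty queue. -/
def waiting (u : ℕ → ℕ × ℕ) : ℕ → ℕ
  | 0 => 0
  | n + 1 => lindley (waiting u n) (u n)

lemma waiting_congr {u v : ℕ → ℕ × ℕ} {n : ℕ} (h : ∀ i < n, u i = v i) :
    waiting u n = waiting v n := by
  induction n with
  | zero => rfl
  | succ n ih =>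
    rw [waiting, waiting, ih fun i hi => h i (by omega), h n n.lt_succ_self]

/-- A packet with zero waiting time is in the situation of packet `0`, so the recursion restarts
with the remaining steps. -/
lemma waiting_add {u : ℕ → ℕ × ℕ} {k : ℕ} (hk : waiting u k = 0) (i : ℕ) :
    waiting u (k + i) = waiting (seqShift k u) i := by
  induction i with
  | zero => exact hk
  | succ i ih => rw [← add_assoc, waiting, ih, waiting]; rfl

lemma measurable_waiting (n : ℕ) : Measurable (fun u : ℕ → ℕ × ℕ => waiting u n) := by
  induction n with
  | zero => exact measurable_const
  | succ n ih =>
    have : Measurable (fun p : ℕ × (ℕ × ℕ) => lindley p.1 p.2) := measurable_of_countable _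
    exact this.comp (ih.prodMk (measurable_pi_apply n))

/-- No packet among the packets `1, …, n` finds the queue empty. -/
def InCycle (u : ℕ → ℕ × ℕ) (n : ℕ) : Prop := ∀ i, 0 < i → i ≤ n → waiting u i ≠ 0

/-- Step `n` itself is not consulted; under an i.i.d. law this makes `u n` independent of the event.
-/
lemma InCycle.congr {u v : ℕ → ℕ × ℕ} {n : ℕ} (h : ∀ i < n, u i = v i) :
    InCycle u n ↔ InCycle v n := by
  refine forall_congr' fun i => imp_congr_right fun _ => imp_congr_right fun hi => ?_
  rw [waiting_congr fun j hj => h j (by omega)]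

lemma measurableSet_inCycle (n : ℕ) : MeasurableSet {u : ℕ → ℕ × ℕ | InCycle u n} := by
  have : {u : ℕ → ℕ × ℕ | InCycle u n} =
      ⋂ i, ⋂ (_ : 0 < i), ⋂ (_ : i ≤ n), {u | waiting u i = 0}ᶜ := by
    ext; simp [InCycle]
  rw [this]
  exact .iInter fun i => .iInter fun _ => .iInter fun _ =>
    ((measurable_waiting i) (measurableSet_singleton 0)).compl

/-- The number of packets that arrive until the queue is found empty again, or `0` if this never
happens. -/
noncomputable def cycleLength (u : ℕ → ℕ × ℕ) : ℕ := sInf {n | 0 < n ∧ waiting u n = 0}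

lemma cycleLength_eq_iff {u : ℕ → ℕ × ℕ} {k : ℕ} (hk : 0 < k) :
    cycleLength u = k ↔ InCycle u (k - 1) ∧ waiting u k = 0 := by
  constructor
  · rintro rfl
    have hmem := Nat.sInf_mem (Nat.nonempty_of_pos_sInf hk)
    refine ⟨fun i hi hi' h0 => ?_, hmem.2⟩
    have : cycleLength u ≤ i := Nat.sInf_le ⟨hi, h0⟩
    omega
  · rintro ⟨h₁, h₂⟩
    refine le_antisymm (Nat.sInf_le ⟨hk, h₂⟩) (le_csInf ⟨k, hk, h₂⟩ fun i hi => ?_)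
    by_contra hlt
    exact h₁ i hi.1 (by omega) hi.2

lemma waiting_cycleLength (u : ℕ → ℕ × ℕ) : waiting u (cycleLength u) = 0 := by
  rcases Nat.eq_zero_or_pos (cycleLength u) with h | h
  · rw [h]; rfl
  · exact ((cycleLength_eq_iff h).1 rfl).2

/-- Positivity excludes the default value `0`: for a cycle that never ends the left side is false
and the right side is always true. -/
lemma lt_cycleLength_iff {u : ℕ → ℕ × ℕ} (hu : 0 < cycleLength u) (n : ℕ) :
    n < cycleLength u ↔ InCycle u n := by
  obtain ⟨h₁, h₂⟩ := (cycleLength_eq_iff hu).1 rfl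
  constructor
  · exact fun h i hi hi' => h₁ i hi (by omega)
  · intro h
    by_contra hlt
    exact h _ hu (by omega) h₂

/-- The cycle length is a stopping time, because the waiting times up to packet `k` use only the
first `k` steps. -/
lemma cycleLength_dependence {k : ℕ} (hk : 0 < k) {u v : ℕ → ℕ × ℕ} (h : ∀ i < k, u i = v i)
    (hu : cycleLength u = k) : cycleLength v = k := by
  rw [cycleLength_eq_iff hk] at hu ⊢
  rwa [← waiting_congr h, ← InCycle.congr fun i hi => h i (by omega)]

lemma measurable_cycleLength : Measurable cycleLength := by
  have hpos : ∀ k, 0 < k → MeasurableSet (cycleLength ⁻¹' {k}) := by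
    intro k hk
    have : cycleLength ⁻¹' {k} = {u | InCycle u (k - 1)} ∩ {u | waiting u k = 0} := by
      ext u
      exact cycleLength_eq_iff hk
    rw [this]
    exact (measurableSet_inCycle _).inter ((measurable_waiting k) (measurableSet_singleton 0))
  refine measurable_to_countable' fun k => ?_
  rcases Nat.eq_zero_or_pos k with rfl | hk
  · have : cycleLength ⁻¹' {0} = (⋃ k, ⋃ (_ : 0 < k), cycleLength ⁻¹' {k})ᶜ := by
      ext u
      simp only [Set.mem_preimage, Set.mem_singleton_iff, Set.mem_compl_iff, Set.mem_iUnion]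
      exact ⟨fun h ⟨i, hi, hi'⟩ => by omega, fun h => by_contra fun h' => h ⟨_, by omega, rfl⟩⟩
    rw [this]
    exact (MeasurableSet.iUnion fun k => .iUnion fun hk => hpos k hk).compl
  · exact hpos k hk

/-- The sum of `F` over the packets of the first cycle. -/
noncomputable def cycleSum {M : Type*} [AddCommMonoid M] (F : ℕ × (ℕ × ℕ) → M)
    (u : ℕ → ℕ × ℕ) : M :=
  ∑ n ∈ Finset.range (cycleLength u), F (waiting u n, u n)

lemma measurable_waiting_pair {M : Type*} [MeasurableSpace M] (F : ℕ × (ℕ × ℕ) → M) (n : ℕ) :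
    Measurable (fun u : ℕ → ℕ × ℕ => F (waiting u n, u n)) :=
  (measurable_of_countable F).comp ((measurable_waiting n).prodMk (measurable_pi_apply n))

lemma measurable_cycleSum (F : ℕ × (ℕ × ℕ) → ℝ) : Measurable (cycleSum F) := by
  have : Measurable (fun p : ℕ × (ℕ → ℕ × ℕ) =>
      ∑ n ∈ Finset.range p.1, F (waiting p.2 n, p.2 n)) :=
    measurable_from_prod_countable_right fun k =>
      Finset.measurable_sum (Finset.range k) fun n _ => measurable_waiting_pair F n
  exact this.comp (measurable_cycleLength.prodMk measurable_id)

lemma cycleSum_dependence {M : Type*} [AddCommMonoid M] (F : ℕ × (ℕ × ℕ) → M) {k : ℕ}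
    (hk : 0 < k) {u v : ℕ → ℕ × ℕ} (h : ∀ i < k, u i = v i) (hu : cycleLength u = k) :
    cycleSum F u = cycleSum F v := by
  unfold cycleSum
  rw [hu, cycleLength_dependence hk h hu]
  refine Finset.sum_congr rfl fun n hn => ?_
  rw [Finset.mem_range] at hn
  rw [h n hn, waiting_congr fun i hi => h i (hi.trans hn)]

/-- The arrivals after the first cycle. -/
noncomputable def nextCycle (u : ℕ → ℕ × ℕ) : ℕ → ℕ × ℕ := seqShift (cycleLength u) u

/-- The path is cut where the queue is found empty; by `waiting_add` each piece is the first cycle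
of a shifted sequence. -/
lemma sum_cycles {M : Type*} [AddCommMonoid M] (F : ℕ × (ℕ × ℕ) → M) (j : ℕ)
    (u : ℕ → ℕ × ℕ) :
    ∑ n ∈ Finset.range (∑ i ∈ Finset.range j, cycleLength (nextCycle^[i] u)),
      F (waiting u n, u n) = ∑ i ∈ Finset.range j, cycleSum F (nextCycle^[i] u) := by
  induction j generalizing u with
  | zero => simp
  | succ j ih =>
    rw [Finset.sum_range_succ', Finset.sum_range_succ', add_comm (∑ i ∈ _, _) (cycleLength _),
      Finset.sum_range_add, add_comm _ (cycleSum F _)]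
    simp only [Function.iterate_succ_apply, Function.iterate_zero, id_eq]
    rw [← ih (nextCycle u)]
    congr 1
    refine Finset.sum_congr rfl fun n _ => ?_
    rw [waiting_add (waiting_cycleLength u)]
    rfl

/-! ### Occupation measure, stationary law and time averages. -/

/-- The occupation measure of the waiting time process over a cycle. -/
noncomputable def cycleOccupation (ν : Measure (ℕ × ℕ)) : Measure ℕ :=
  Measure.sum fun n => ((iidMeasure ν).restrict {u | InCycle u n}).map (fun u => waiting u n)

lemma lintegral_cycleOccupation (ν : Measure (ℕ × ℕ)) (f : ℕ → ENNReal) :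
    ∫⁻ w, f w ∂cycleOccupation ν = ∑' n, ∫⁻ u in {u | InCycle u n}, f (waiting u n) ∂iidMeasure ν := by
  rw [cycleOccupation, lintegral_sum_measure]
  refine tsum_congr fun n => ?_
  rw [lintegral_map (measurable_of_countable f) (measurable_waiting n)]

/-- The waiting time of packet `n` and the event depend only on earlier steps, so the tail from `n`
on can be replaced by an independent copy, and step `n` integrated out separately. -/
lemma lintegral_inCycle (ν : Measure (ℕ × ℕ)) [IsProbabilityMeasure ν]
    (F : ℕ × (ℕ × ℕ) → ENNReal) (n : ℕ) :
    ∫⁻ u in {u | InCycle u n}, F (waiting u n, u n) ∂iidMeasure ν =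
      ∫⁻ u in {u | InCycle u n}, ∫⁻ z, F (waiting u n, z) ∂ν ∂iidMeasure ν := by
  have hm := measurable_waiting_pair F n
  have hind : Measurable ({u | InCycle u n}.indicator
      (fun u : ℕ → ℕ × ℕ => F (waiting u n, u n))) := hm.indicator (measurableSet_inCycle n)
  rw [← lintegral_indicator (measurableSet_inCycle n),
    ← lintegral_indicator (measurableSet_inCycle n)]
  conv_lhs => rw [← map_seqConcat ν n]
  rw [lintegral_map hind (measurable_seqConcat n),
    lintegral_prod (fun p : (ℕ → ℕ × ℕ) × (ℕ → ℕ × ℕ) => {u | InCycle u n}.indicator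
      (fun u => F (waiting u n, u n)) (seqConcat n p.1 p.2))
      (hind.comp (measurable_seqConcat n)).aemeasurable]
  refine lintegral_congr fun u => ?_
  have hW : ∀ v, waiting (seqConcat n u v) n = waiting u n := fun v =>
    waiting_congr fun i hi => seqConcat_of_lt hi u v
  have hI : ∀ v, InCycle (seqConcat n u v) n ↔ InCycle u n := fun v =>
    InCycle.congr fun i hi => seqConcat_of_lt hi u v
  have h0 : ∀ v, seqConcat n u v n = v 0 := fun v => seqConcat_add n 0 u v
  by_cases h : InCycle u n
  · have hmp := measurePreserving_eval_infinitePi (fun _ : ℕ => ν) 0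
    rw [Set.indicator_of_mem (show u ∈ {u | InCycle u n} from h),
      ← hmp.lintegral_comp (f := fun z => F (waiting u n, z)) (measurable_of_countable _)]
    refine lintegral_congr fun v => ?_
    rw [Set.indicator_of_mem (show seqConcat n u v ∈ {u | InCycle u n} from (hI v).2 h), hW, h0]
  · rw [Set.indicator_of_notMem (show u ∉ {u | InCycle u n} from h)]
    refine (lintegral_congr fun v => ?_).trans lintegral_zero
    exact Set.indicator_of_notMem (fun h' : InCycle (seqConcat n u v) n => h ((hI v).1 h')) _

/-- The total mass of the occupation measure is the sum of the probabilities of `InCycle u n`. If it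
is finite, these tend to zero, and each bounds the probability of an endless cycle. -/
lemma ae_cycleLength_pos (ν : Measure (ℕ × ℕ)) [IsProbabilityMeasure ν]
    [IsFiniteMeasure (cycleOccupation ν)] : ∀ᵐ u ∂iidMeasure ν, 0 < cycleLength u := by
  have hsum : ∑' n, iidMeasure ν {u | InCycle u n} ≠ ⊤ := by
    have := lintegral_cycleOccupation ν (fun _ => 1)
    simp only [lintegral_const, one_mul, MeasurableSet.univ, Measure.restrict_apply,
      Set.univ_inter] at this
    rw [← this]
    exact measure_ne_top _ _
  have hlim := ENNReal.tendsto_atTop_zero_of_tsum_ne_top hsum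
  have hle : ∀ n, iidMeasure ν {u | cycleLength u = 0} ≤ iidMeasure ν {u | InCycle u n} := by
    refine fun n => measure_mono fun u (hu : cycleLength u = 0) i hi _ h0 => ?_
    have hne : {n | 0 < n ∧ waiting u n = 0}.Nonempty := ⟨i, hi, h0⟩
    have := (Nat.sInf_mem hne).1
    rw [cycleLength] at hu
    omega
  have h0 : iidMeasure ν {u | cycleLength u = 0} = 0 :=
    le_antisymm (ge_of_tendsto' hlim hle) zero_le
  refine measure_mono_null (fun u hu => ?_) h0
  simp only [Set.mem_compl_iff, Set.mem_ofPred_eq] at hu ⊢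
  omega

/-- A Wald-type identity: the sum over a cycle is a series of terms restricted to `InCycle u n`, and
in each term the step is independent of the waiting time and of the event. Hence the product
measure. -/
lemma lintegral_cycleSum (ν : Measure (ℕ × ℕ)) [IsProbabilityMeasure ν]
    [IsFiniteMeasure (cycleOccupation ν)] (F : ℕ × (ℕ × ℕ) → ENNReal) :
    ∫⁻ u, cycleSum F u ∂iidMeasure ν = ∫⁻ p, F p ∂(cycleOccupation ν).prod ν := by
  rw [lintegral_prod _ (measurable_of_countable F).aemeasurable, lintegral_cycleOccupation]
  simp_rw [← lintegral_inCycle, ← lintegral_indicator (measurableSet_inCycle _)]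
  rw [← lintegral_tsum fun n =>
    ((measurable_waiting_pair F n).indicator (measurableSet_inCycle n)).aemeasurable]
  refine lintegral_congr_ae ?_
  filter_upwards [ae_cycleLength_pos ν] with u hu
  rw [tsum_eq_sum (s := Finset.range (cycleLength u))]
  · refine Finset.sum_congr rfl fun n hn => ?_
    rw [Set.indicator_of_mem]
    exact (lt_cycleLength_iff hu n).1 (Finset.mem_range.1 hn)
  · intro n hn
    rw [Set.indicator_of_notMem]
    exact fun h => hn (Finset.mem_range.2 ((lt_cycleLength_iff hu n).2 h))

lemma integral_cycleSum_of_nonneg (ν : Measure (ℕ × ℕ)) [IsProbabilityMeasure ν]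
    [IsFiniteMeasure (cycleOccupation ν)] {F : ℕ × (ℕ × ℕ) → ℝ} (h0 : ∀ p, 0 ≤ F p)
    (hF : Integrable F ((cycleOccupation ν).prod ν)) :
    Integrable (cycleSum F) (iidMeasure ν) ∧
      ∫ u, cycleSum F u ∂iidMeasure ν = ∫ p, F p ∂(cycleOccupation ν).prod ν := by
  have hC0 : ∀ u, 0 ≤ cycleSum F u := fun u => Finset.sum_nonneg fun _ _ => h0 _
  have hlin : ∫⁻ u, ENNReal.ofReal (cycleSum F u) ∂iidMeasure ν =
      ∫⁻ p, ENNReal.ofReal (F p) ∂(cycleOccupation ν).prod ν := by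
    rw [← lintegral_cycleSum]
    refine lintegral_congr fun u => ?_
    exact ENNReal.ofReal_sum_of_nonneg fun _ _ => h0 _
  have hm := (measurable_cycleSum F).aestronglyMeasurable (μ := iidMeasure ν)
  have hfin : ∫⁻ p, ENNReal.ofReal (F p) ∂(cycleOccupation ν).prod ν < ⊤ :=
    hF.lintegral_lt_top
  refine ⟨⟨hm, ?_⟩, ?_⟩
  · rw [hasFiniteIntegral_iff_ofReal (Eventually.of_forall hC0), hlin]
    exact hfin
  · rw [integral_eq_lintegral_of_nonneg_ae (Eventually.of_forall hC0) hm, hlin,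
      integral_eq_lintegral_of_nonneg_ae (Eventually.of_forall h0) hF.aestronglyMeasurable]

lemma integral_cycleSum (ν : Measure (ℕ × ℕ)) [IsProbabilityMeasure ν]
    [IsFiniteMeasure (cycleOccupation ν)] {F : ℕ × (ℕ × ℕ) → ℝ}
    (hF : Integrable F ((cycleOccupation ν).prod ν)) :
    Integrable (cycleSum F) (iidMeasure ν) ∧
      ∫ u, cycleSum F u ∂iidMeasure ν = ∫ p, F p ∂(cycleOccupation ν).prod ν := by
  obtain ⟨h₁, h₁'⟩ := integral_cycleSum_of_nonneg ν (fun p => le_max_right _ _) hF.pos_part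
  obtain ⟨h₂, h₂'⟩ := integral_cycleSum_of_nonneg ν (fun p => le_max_right _ _) hF.neg_part
  have hdecomp : ∀ p, F p = max (F p) 0 - max (-F p) 0 := fun p => by
    rcases le_total (F p) 0 with h | h <;> simp [h]
  have hsub : cycleSum F = fun u => cycleSum (fun p => max (F p) 0) u -
      cycleSum (fun p => max (-F p) 0) u := by
    funext u
    unfold cycleSum
    rw [← Finset.sum_sub_distrib]
    exact Finset.sum_congr rfl fun n _ => hdecomp _
  rw [hsub]
  refine ⟨h₁.sub h₂, ?_⟩
  rw [integral_sub h₁ h₂, h₁', h₂', ← integral_sub hF.pos_part hF.neg_part]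
  exact integral_congr_ae (Eventually.of_forall fun p => (hdecomp p).symm)

lemma one_le_cycleOccupation_univ (ν : Measure (ℕ × ℕ)) [IsProbabilityMeasure ν] :
    1 ≤ cycleOccupation ν Set.univ := by
  have := lintegral_cycleOccupation ν (fun _ => 1)
  simp only [lintegral_const, one_mul, MeasurableSet.univ, Measure.restrict_apply,
    Set.univ_inter] at this
  rw [this]
  refine le_trans ?_ (ENNReal.le_tsum 0)
  have : {u : ℕ → ℕ × ℕ | InCycle u 0} = Set.univ := by
    ext u
    simp only [Set.mem_ofPred_eq, Set.mem_univ, iff_true]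
    intro i hi hi'
    omega
  rw [this, measure_univ]

/-- The cycle sums are i.i.d. by regeneration at the end of each cycle, so the strong law applies to
their common law. -/
lemma tendsto_cycle_average (ν : Measure (ℕ × ℕ)) [IsProbabilityMeasure ν]
    [IsFiniteMeasure (cycleOccupation ν)] {F : ℕ × (ℕ × ℕ) → ℝ}
    (hF : Integrable F ((cycleOccupation ν).prod ν)) :
    ∀ᵐ u ∂iidMeasure ν, Tendsto
      (fun j : ℕ => (∑ i ∈ Finset.range j, cycleSum F (nextCycle^[i] u)) / j) atTop
      (nhds (∫ p, F p ∂(cycleOccupation ν).prod ν)) := by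
  obtain ⟨hint, hval⟩ := integral_cycleSum ν hF
  have hm := measurable_cycleSum F
  have hθ : MeasurePreserving nextCycle (iidMeasure ν) (iidMeasure ν) :=
    measurePreserving_regeneration ν measurable_cycleLength (ae_cycleLength_pos ν)
      fun k hk u v h h' => cycleLength_dependence hk h h'
  have hlaw := map_iterate_eq_iidMeasure (P := iidMeasure ν) hm hθ fun A D hA hD =>
    measure_regeneration ν measurable_cycleLength hm (ae_cycleLength_pos ν)
      (fun k hk u v h h' => ⟨cycleLength_dependence hk h h', cycleSum_dependence F hk h h'⟩) hA hD
  have : IsProbabilityMeasure ((iidMeasure ν).map (cycleSum F)) :=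
    Measure.isProbabilityMeasure_map hm.aemeasurable
  have hslln := strong_law_iidMeasure ((iidMeasure ν).map (cycleSum F)) measurable_id
    ((integrable_map_measure aestronglyMeasurable_id hm.aemeasurable).2 hint)
  rw [← hlaw] at hslln
  have := ae_of_ae_map (measurable_pi_iff.2 fun n =>
    hm.comp (hθ.measurable.iterate n)).aemeasurable hslln
  rw [integral_map hm.aemeasurable measurable_id.aestronglyMeasurable] at this
  simp only [id] at this
  rwa [hval] at this

/-- Renewal-reward: the average over packets is the mean reward of a cycle divided by its mean
length. Nonnegativity makes the partial sums monotone, so that convergence at the ends of cycles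
suffices. -/
lemma tendsto_waiting_average_of_nonneg (ν : Measure (ℕ × ℕ)) [IsProbabilityMeasure ν]
    [IsFiniteMeasure (cycleOccupation ν)] {F : ℕ × (ℕ × ℕ) → ℝ} (h0 : ∀ p, 0 ≤ F p)
    (hF : Integrable F ((cycleOccupation ν).prod ν)) :
    ∀ᵐ u ∂iidMeasure ν, Tendsto
      (fun n : ℕ => (∑ i ∈ Finset.range n, F (waiting u i, u i)) / n) atTop
      (nhds ((∫ p, F p ∂(cycleOccupation ν).prod ν) / (cycleOccupation ν).real Set.univ)) := by
  have hpos : 0 < (cycleOccupation ν).real Set.univ :=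
    ENNReal.toReal_pos (one_pos.trans_le (one_le_cycleOccupation_univ ν)).ne' (measure_ne_top _ _)
  filter_upwards [tendsto_cycle_average ν hF,
    tendsto_cycle_average ν (F := fun _ => 1) (integrable_const _)] with u hu hu'
  simp only [integral_const, smul_eq_mul, mul_one] at hu'
  have huniv : ((cycleOccupation ν).prod ν).real Set.univ =
      (cycleOccupation ν).real Set.univ := by
    rw [← Set.univ_prod_univ, measureReal_prod_prod, probReal_univ (μ := ν), mul_one]
  rw [huniv] at hu'
  refine tendsto_div_of_monotone_of_tendsto_comp
    (a := fun n => ∑ i ∈ Finset.range n, F (waiting u i, u i))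
    (c := fun j => ∑ i ∈ Finset.range j, cycleLength (nextCycle^[i] u)) ?_ hpos ?_ ?_
  · exact fun m n hmn => Finset.sum_le_sum_of_subset_of_nonneg
      (Finset.range_mono hmn) fun _ _ _ => h0 _
  · refine hu'.congr fun j => ?_
    simp [cycleSum]
  · simpa only [sum_cycles] using hu

/-- The stationary law of the waiting time. -/
noncomputable def stationaryWaiting (ν : Measure (ℕ × ℕ)) : Measure ℕ :=
  (cycleOccupation ν Set.univ)⁻¹ • cycleOccupation ν

lemma isProbabilityMeasure_stationaryWaiting (ν : Measure (ℕ × ℕ)) [IsProbabilityMeasure ν]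
    [IsFiniteMeasure (cycleOccupation ν)] : IsProbabilityMeasure (stationaryWaiting ν) := by
  constructor
  rw [stationaryWaiting, Measure.smul_apply, smul_eq_mul]
  exact ENNReal.inv_mul_cancel (one_pos.trans_le (one_le_cycleOccupation_univ ν)).ne'
    (measure_ne_top _ _)

lemma stationaryWaiting_prod (ν : Measure (ℕ × ℕ)) [IsProbabilityMeasure ν]
    [IsFiniteMeasure (cycleOccupation ν)] : (stationaryWaiting ν).prod ν =
      (cycleOccupation ν Set.univ)⁻¹ • (cycleOccupation ν).prod ν := by
  rw [stationaryWaiting, Measure.prod_smul_left]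

lemma integrable_stationaryWaiting_prod_iff (ν : Measure (ℕ × ℕ)) [IsProbabilityMeasure ν]
    [IsFiniteMeasure (cycleOccupation ν)] {F : ℕ × (ℕ × ℕ) → ℝ} :
    Integrable F ((stationaryWaiting ν).prod ν) ↔ Integrable F ((cycleOccupation ν).prod ν) := by
  rw [stationaryWaiting_prod, integrable_smul_measure]
  · exact ENNReal.inv_ne_zero.2 (measure_ne_top _ _)
  · exact ENNReal.inv_ne_top.2 (one_pos.trans_le (one_le_cycleOccupation_univ ν)).ne'

/-- The time averages of a functional of the waiting time and of the next step converge to its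
stationary mean. -/
theorem tendsto_waiting_average (ν : Measure (ℕ × ℕ)) [IsProbabilityMeasure ν]
    [IsFiniteMeasure (cycleOccupation ν)] {F : ℕ × (ℕ × ℕ) → ℝ}
    (hF : Integrable F ((stationaryWaiting ν).prod ν)) :
    ∀ᵐ u ∂iidMeasure ν, Tendsto
      (fun n : ℕ => (∑ i ∈ Finset.range n, F (waiting u i, u i)) / n) atTop
      (nhds (∫ p, F p ∂(stationaryWaiting ν).prod ν)) := by
  rw [integrable_stationaryWaiting_prod_iff] at hF
  have hdecomp : ∀ p, F p = max (F p) 0 - max (-F p) 0 := fun p => by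
    rcases le_total (F p) 0 with h | h <;> simp [h]
  filter_upwards [tendsto_waiting_average_of_nonneg ν (fun p => le_max_right _ _) hF.pos_part,
    tendsto_waiting_average_of_nonneg ν (fun p => le_max_right _ _) hF.neg_part] with u h₁ h₂
  have hval : ∫ p, F p ∂(stationaryWaiting ν).prod ν =
      (∫ p, max (F p) 0 ∂(cycleOccupation ν).prod ν) / (cycleOccupation ν).real Set.univ -
      (∫ p, max (-F p) 0 ∂(cycleOccupation ν).prod ν) / (cycleOccupation ν).real Set.univ := by
    rw [stationaryWaiting_prod, integral_smul_measure, ENNReal.toReal_inv, smul_eq_mul,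
      ← sub_div, ← integral_sub hF.pos_part hF.neg_part, ← measureReal_def, div_eq_inv_mul]
    congr 1
    exact integral_congr_ae (Eventually.of_forall hdecomp)
  rw [hval]
  refine (h₁.sub h₂).congr fun n => ?_
  rw [← sub_div, ← Finset.sum_sub_distrib]
  congr 1
  exact Finset.sum_congr rfl fun i _ => (hdecomp _).symm

/-- The stationary mean of an increment is zero. -/
theorem integral_increment_eq_zero (ν : Measure (ℕ × ℕ)) [IsProbabilityMeasure ν]
    [IsFiniteMeasure (cycleOccupation ν)] (g : ℕ → ℝ)
    (hg : Integrable (fun p : ℕ × (ℕ × ℕ) => g (lindley p.1 p.2) - g p.1)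
      ((stationaryWaiting ν).prod ν)) :
    ∫ p, (g (lindley p.1 p.2) - g p.1) ∂(stationaryWaiting ν).prod ν = 0 := by
  rw [integrable_stationaryWaiting_prod_iff] at hg
  -- Over a cycle the increments telescope from waiting time `0` to waiting time `0`. Only the
  -- increment has to be integrable, not `g` itself; for the square this spares a second moment of
  -- the waiting time.
  have hzero : cycleSum (fun p : ℕ × (ℕ × ℕ) => g (lindley p.1 p.2) - g p.1) = 0 := by
    funext u
    change ∑ n ∈ Finset.range (cycleLength u), (g (waiting u (n + 1)) - g (waiting u n)) = 0
    rw [Finset.sum_range_sub (fun n => g (waiting u n)), waiting_cycleLength]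
    exact sub_self _
  have := (integral_cycleSum ν hg).2
  rw [hzero] at this
  rw [stationaryWaiting_prod, integral_smul_measure, ← this]
  simp

/-! ### Moments of the geometric distribution -/

lemma integrable_geometricMeasure_comp_succ {p : unitInterval} (hp : p ≠ 0) {f : ℕ → ℝ}
    (hf : Integrable (fun n => f (n + 1)) (geometricMeasure p)) :
    Integrable f (geometricMeasure p) := by
  rw [integrable_geometricMeasure_iff hp] at hf ⊢
  rw [← summable_nat_add_iff 1]
  refine (hf.mul_left (1 - p : ℝ)).congr fun n => ?_
  rw [pow_succ]
  ring

/-- Conditioning on the first trial. -/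
lemma integral_geometricMeasure_step {p : unitInterval} (hp : p ≠ 0) {f : ℕ → ℝ}
    (hf : Integrable (fun n => f (n + 1)) (geometricMeasure p)) :
    ∫ n, f n ∂geometricMeasure p =
      p * f 0 + (1 - p) * ∫ n, f (n + 1) ∂geometricMeasure p := by
  have h₀ := hasSum_integral_geometricMeasure hp (integrable_geometricMeasure_comp_succ hp hf)
  have h₁ := (hasSum_integral_geometricMeasure hp hf).mul_left (1 - p : ℝ)
  have h₂ := (hasSum_nat_add_iff' 1).2 h₀
  have h₃ : HasSum (fun n : ℕ => ((1 - p : ℝ) ^ (n + 1) * p) • f (n + 1))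
      ((1 - p) * ∫ n, f (n + 1) ∂geometricMeasure p) := by
    refine h₁.congr_fun fun n => ?_
    simp only [smul_eq_mul, pow_succ]
    ring
  have := h₂.unique h₃
  simp only [Finset.range_one, Finset.sum_singleton, pow_zero, one_mul, smul_eq_mul] at this
  linarith

lemma integrable_geometricMeasure_pow {p : unitInterval} (hp : p ≠ 0) (k : ℕ) :
    Integrable (fun n : ℕ => (n : ℝ) ^ k) (geometricMeasure p) := by
  rw [integrable_geometricMeasure_iff hp]
  have h1 : (p : ℝ) ≤ 1 := p.2.2
  have h0 : 0 < (p : ℝ) := lt_of_le_of_ne p.2.1 fun h => hp (Subtype.ext h.symm)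
  have hq : ‖(1 - p : ℝ)‖ < 1 := by
    rw [Real.norm_eq_abs, abs_lt]
    constructor <;> linarith
  refine ((summable_pow_mul_geometric_of_norm_lt_one k hq).mul_left (p : ℝ)).congr fun n => ?_
  rw [Real.norm_eq_abs, abs_of_nonneg (by positivity)]
  ring

lemma integrable_geometricMeasure_succ {p : unitInterval} (hp : p ≠ 0) :
    Integrable (fun n : ℕ => (n : ℝ) + 1) (geometricMeasure p) := by
  simpa using (integrable_geometricMeasure_pow hp 1).add (integrable_const (1 : ℝ))

lemma integrable_geometricMeasure_succ_sq {p : unitInterval} (hp : p ≠ 0) :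
    Integrable (fun n : ℕ => ((n : ℝ) + 1) ^ 2) (geometricMeasure p) := by
  refine ((integrable_geometricMeasure_pow hp 2).add
    (((integrable_geometricMeasure_pow hp 1).const_mul 2).add (integrable_const (1 : ℝ)))).congr
    (Eventually.of_forall fun n => ?_)
  simp only [Pi.add_apply]
  ring

lemma integral_geometricMeasure_succ {p : unitInterval} (hp : p ≠ 0) :
    ∫ n : ℕ, ((n : ℝ) + 1) ∂geometricMeasure p = 1 / p := by
  have hp' : (p : ℝ) ≠ 0 := fun h => hp (Subtype.ext h)
  have hi := integrable_geometricMeasure_succ hp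
  have hi' : Integrable (fun n : ℕ => ((n + 1 : ℕ) : ℝ) + 1) (geometricMeasure p) := by
    simpa using hi.add (integrable_const (1 : ℝ))
  have h := integral_geometricMeasure_step hp (f := fun n : ℕ => (n : ℝ) + 1) hi'
  have h' : ∫ n : ℕ, (((n + 1 : ℕ) : ℝ) + 1) ∂geometricMeasure p =
      ∫ n : ℕ, ((n : ℝ) + 1) ∂geometricMeasure p + 1 := by
    push_cast
    rw [integral_add hi (integrable_const _)]
    simp
  rw [h'] at h
  push_cast at h
  rw [eq_div_iff hp']
  linarith

lemma integral_geometricMeasure_succ_sq {p : unitInterval} (hp : p ≠ 0) :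
    ∫ n : ℕ, ((n : ℝ) + 1) ^ 2 ∂geometricMeasure p = (2 - p) / (p : ℝ) ^ 2 := by
  have hp' : (p : ℝ) ≠ 0 := fun h => hp (Subtype.ext h)
  have hi := integrable_geometricMeasure_succ hp
  have hi₂ := integrable_geometricMeasure_succ_sq hp
  have hi₃ : Integrable (fun n : ℕ => 2 * ((n : ℝ) + 1) + 1) (geometricMeasure p) :=
    (hi.const_mul 2).add (integrable_const _)
  have heq : ∀ n : ℕ, (((n + 1 : ℕ) : ℝ) + 1) ^ 2 = ((n : ℝ) + 1) ^ 2 + (2 * ((n : ℝ) + 1) + 1) :=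
    fun n => by push_cast; ring
  have hi' : Integrable (fun n : ℕ => (((n + 1 : ℕ) : ℝ) + 1) ^ 2) (geometricMeasure p) := by
    simp_rw [heq]
    exact hi₂.add hi₃
  have h := integral_geometricMeasure_step hp (f := fun n : ℕ => ((n : ℝ) + 1) ^ 2) hi'
  have h' : ∫ n : ℕ, (((n + 1 : ℕ) : ℝ) + 1) ^ 2 ∂geometricMeasure p =
      (∫ n : ℕ, ((n : ℝ) + 1) ^ 2 ∂geometricMeasure p) + (2 * (1 / (p : ℝ)) + 1) := by
    simp_rw [heq]
    rw [integral_add hi₂ hi₃,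
      integral_add (hi.const_mul 2) (integrable_const _), integral_const_mul,
      integral_geometricMeasure_succ hp]
    simp
  rw [h'] at h
  have h2 : (p : ℝ) * ∫ n : ℕ, ((n : ℝ) + 1) ^ 2 ∂geometricMeasure p =
      p + (1 - p) * (2 * (1 / p) + 1) := by
    push_cast at h
    linarith
  have h3 : (p : ℝ) * (1 / p) = 1 := by field_simp
  rw [eq_div_iff (pow_ne_zero 2 hp')]
  calc (∫ n : ℕ, ((n : ℝ) + 1) ^ 2 ∂geometricMeasure p) * (p : ℝ) ^ 2
      = p * ((p : ℝ) * ∫ n : ℕ, ((n : ℝ) + 1) ^ 2 ∂geometricMeasure p) := by ring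
    _ = p ^ 2 + (1 - p) * (2 * (p * (1 / p)) + p) := by rw [h2]; ring
    _ = 2 - p := by rw [h3]; ring

lemma integrable_geometricMeasure_sub (p : unitInterval) (g : ℕ → ℝ) (t : ℕ) :
    Integrable (fun n : ℕ => g (t - (n + 1))) (geometricMeasure p) := by
  refine Integrable.of_bound (measurable_of_countable _).aestronglyMeasurable
    (∑ k ∈ Finset.range (t + 1), |g k|) (Eventually.of_forall fun n => ?_)
  exact Finset.single_le_sum (f := fun k => |g k|) (fun _ _ => abs_nonneg _)
    (Finset.mem_range.2 (by omega))

/-- Success in the first trial leaves `t`; after a failure the situation is the same with `t` in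
place of `t + 1`. The truncated moments below follow from this recursion by induction on `t`. -/
lemma integral_geometricMeasure_sub_succ {p : unitInterval} (hp : p ≠ 0) (g : ℕ → ℝ) (t : ℕ) :
    ∫ n : ℕ, g (t + 1 - (n + 1)) ∂geometricMeasure p =
      p * g t + (1 - p) * ∫ n : ℕ, g (t - (n + 1)) ∂geometricMeasure p := by
  have h := integral_geometricMeasure_step hp (f := fun n : ℕ => g (t + 1 - (n + 1)))
    (by simpa only [Nat.add_sub_add_right] using integrable_geometricMeasure_sub p g t)
  simpa only [Nat.add_sub_add_right, zero_add, Nat.add_sub_cancel] using h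

/-- The subtraction is a positive part. The last term is the mean overshoot: the gap exceeds `t`
with probability `(1 - p) ^ t`, and by lack of memory the excess then has mean `1 / p`. -/
lemma integral_geometricMeasure_sub {p : unitInterval} (hp : p ≠ 0) (t : ℕ) :
    ∫ n : ℕ, ((t - (n + 1) : ℕ) : ℝ) ∂geometricMeasure p = t - 1 / p + (1 - p) ^ t / p := by
  have hp' : (p : ℝ) ≠ 0 := fun h => hp (Subtype.ext h)
  induction t with
  | zero => simp
  | succ t ih =>
    rw [integral_geometricMeasure_sub_succ hp (fun k => (k : ℝ)), ih]
    push_cast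
    field_simp
    ring

lemma integral_geometricMeasure_sub_sq {p : unitInterval} (hp : p ≠ 0) (t : ℕ) :
    ∫ n : ℕ, ((t - (n + 1) : ℕ) : ℝ) ^ 2 ∂geometricMeasure p =
      (t : ℝ) ^ 2 - 2 * t / p + (2 - p) / (p : ℝ) ^ 2 * (1 - (1 - p) ^ t) := by
  have hp' : (p : ℝ) ≠ 0 := fun h => hp (Subtype.ext h)
  induction t with
  | zero => simp
  | succ t ih =>
    rw [integral_geometricMeasure_sub_succ hp (fun k => (k : ℝ) ^ 2), ih]
    push_cast
    field_simp
    ring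

/-- For a gap between `1` and `t` the two geometric factors multiply to the same value, which
produces the term linear in `t`. The factor `1 - p` on both sides avoids a division that would fail
for `p = 1`. -/
lemma integral_geometricMeasure_pow_sub {p : unitInterval} (hp : p ≠ 0) (t : ℕ) :
    (1 - p) * ∫ n : ℕ, (1 - p : ℝ) ^ (t - (n + 1)) ∂geometricMeasure p =
      p * t * (1 - p : ℝ) ^ t + (1 - p) * (1 - p : ℝ) ^ t := by
  induction t with
  | zero => simp
  | succ t ih =>
    rw [integral_geometricMeasure_sub_succ hp (fun k => (1 - p : ℝ) ^ k), mul_add,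
      mul_left_comm (1 - p : ℝ) (1 - p : ℝ), ih]
    push_cast
    ring

lemma integral_geometricMeasure_sub_ne_zero {p : unitInterval} (hp : p ≠ 0) (t : ℕ) :
    ∫ n : ℕ, (if t + 1 - (n + 1) = 0 then (0 : ℝ) else 1) ∂geometricMeasure p =
      1 - (1 - p) ^ t := by
  induction t with
  | zero => simp
  | succ t ih =>
    rw [integral_geometricMeasure_sub_succ hp (fun k => if k = 0 then (0 : ℝ) else 1), ih,
      if_neg (Nat.succ_ne_zero t), pow_succ]
    ring

lemma integrable_geometricMeasure_succ_mul_sub {p : unitInterval} (hp : p ≠ 0) (t : ℕ) :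
    Integrable (fun n : ℕ => ((n : ℝ) + 1) * ((t - (n + 1) : ℕ) : ℝ)) (geometricMeasure p) := by
  refine (integrable_geometricMeasure_succ hp).mul_bdd (c := t)
    (measurable_of_countable _).aestronglyMeasurable (Eventually.of_forall fun n => ?_)
  rw [Real.norm_natCast]
  exact_mod_cast Nat.sub_le _ _

lemma integral_geometricMeasure_succ_mul_sub {p : unitInterval} (hp : p ≠ 0) (t : ℕ) :
    ∫ n : ℕ, ((n : ℝ) + 1) * ((t - (n + 1) : ℕ) : ℝ) ∂geometricMeasure p =
      t / p - (2 - p) / (p : ℝ) ^ 2 + (1 - p) ^ t * ((2 - p) / (p : ℝ) ^ 2 + t / p) := by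
  have hp' : (p : ℝ) ≠ 0 := fun h => hp (Subtype.ext h)
  induction t with
  | zero => simp
  | succ t ih =>
    have heq : ∀ n : ℕ, (((n + 1 : ℕ) : ℝ) + 1) * ((t + 1 - (n + 1 + 1) : ℕ) : ℝ) =
        ((n : ℝ) + 1) * ((t - (n + 1) : ℕ) : ℝ) + ((t - (n + 1) : ℕ) : ℝ) := fun n => by
      rw [Nat.add_sub_add_right]
      push_cast
      ring
    have hi₁ := integrable_geometricMeasure_succ_mul_sub hp t
    have hi₂ := integrable_geometricMeasure_sub p (fun k => (k : ℝ)) t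
    rw [integral_geometricMeasure_step hp
      (f := fun n : ℕ => ((n : ℝ) + 1) * ((t + 1 - (n + 1) : ℕ) : ℝ))
      (by simp_rw [heq]; exact hi₁.add hi₂)]
    simp_rw [heq]
    rw [integral_add hi₁ hi₂, ih, integral_geometricMeasure_sub hp]
    simp only [zero_add, Nat.add_sub_cancel]
    push_cast
    field_simp
    ring

/-! ### Stability: finiteness and first moment of the occupation measure. -/

/-- A Foster-Lyapunov bound for the occupation measure of a cycle. -/
theorem lintegral_cycleOccupation_le (ν : Measure (ℕ × ℕ)) [IsProbabilityMeasure ν]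
    {g b c : ℕ → ENNReal} (h0 : g 0 = 0)
    (hdrift : ∀ w, ∫⁻ z, g (lindley w z) ∂ν + c w ≤ g w + b w) :
    ∫⁻ w, c w ∂cycleOccupation ν ≤ ∫⁻ w, b w ∂cycleOccupation ν := by
  -- Since `g` vanishes at `0`, restricting to the event that the cycle continues past packet `n +
  -- 1` loses nothing.
  have hsucc : ∀ n, ∫⁻ u in {u | InCycle u (n + 1)}, g (waiting u (n + 1)) ∂iidMeasure ν =
      ∫⁻ u in {u | InCycle u n}, ∫⁻ z, g (lindley (waiting u n) z) ∂ν ∂iidMeasure ν := by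
    intro n
    rw [← lintegral_inCycle ν (fun p => g (lindley p.1 p.2)),
      ← lintegral_indicator (measurableSet_inCycle _),
      ← lintegral_indicator (measurableSet_inCycle _)]
    refine lintegral_congr fun u => ?_
    change _ = Set.indicator _ (fun u => g (waiting u (n + 1))) u
    by_cases hn : InCycle u n
    · rw [Set.indicator_of_mem (show u ∈ {u | InCycle u n} from hn)]
      by_cases hw : waiting u (n + 1) = 0
      · rw [Set.indicator_of_notMem, hw, h0]
        exact fun h : InCycle u (n + 1) => h (n + 1) n.succ_pos le_rfl hw
      · refine Set.indicator_of_mem (show InCycle u (n + 1) from fun i hi hi' => ?_) _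
        rcases hi'.eq_or_lt with rfl | hlt
        · exact hw
        · exact hn i hi (by omega)
    · rw [Set.indicator_of_notMem (show u ∉ {u | InCycle u n} from hn),
        Set.indicator_of_notMem]
      exact fun h : InCycle u (n + 1) => hn fun i hi hi' => h i hi (by omega)
  have hm : ∀ (f : ℕ → ENNReal) n, Measurable (fun u : ℕ → ℕ × ℕ => f (waiting u n)) :=
    fun f n => measurable_waiting_pair (fun p => f p.1) n
  -- The drift inequality summed over packets: the `g` terms telescope and start from `g 0 = 0`. The
  -- one that survives is nonnegative and is dropped at the end.
  have hpartial : ∀ N, ∫⁻ u in {u | InCycle u N}, g (waiting u N) ∂iidMeasure ν +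
      ∑ n ∈ Finset.range N, ∫⁻ u in {u | InCycle u n}, c (waiting u n) ∂iidMeasure ν ≤
      ∑ n ∈ Finset.range N, ∫⁻ u in {u | InCycle u n}, b (waiting u n) ∂iidMeasure ν := by
    intro N
    induction N with
    | zero => simp [waiting, h0]
    | succ N ih =>
      rw [Finset.sum_range_succ, Finset.sum_range_succ, hsucc]
      calc _ = (∫⁻ u in {u | InCycle u N}, (∫⁻ z, g (lindley (waiting u N) z) ∂ν +
            c (waiting u N)) ∂iidMeasure ν) +
            ∑ n ∈ Finset.range N, ∫⁻ u in {u | InCycle u n}, c (waiting u n) ∂iidMeasure ν := by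
            rw [lintegral_add_right _ (hm c N)]
            ring
        _ ≤ (∫⁻ u in {u | InCycle u N}, (g (waiting u N) + b (waiting u N)) ∂iidMeasure ν) +
            ∑ n ∈ Finset.range N, ∫⁻ u in {u | InCycle u n}, c (waiting u n) ∂iidMeasure ν := by
            exact add_le_add (lintegral_mono fun u => hdrift _) le_rfl
        _ = (∫⁻ u in {u | InCycle u N}, g (waiting u N) ∂iidMeasure ν +
            ∑ n ∈ Finset.range N, ∫⁻ u in {u | InCycle u n}, c (waiting u n) ∂iidMeasure ν) +
            ∫⁻ u in {u | InCycle u N}, b (waiting u N) ∂iidMeasure ν := by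
            rw [lintegral_add_right _ (hm b N)]
            ring
        _ ≤ _ := by gcongr
  rw [lintegral_cycleOccupation, lintegral_cycleOccupation]
  refine ENNReal.tsum_le_of_sum_range_le fun N => ?_
  exact (le_add_self.trans (hpartial N)).trans (ENNReal.sum_le_tsum _)

/-- Within a cycle only packet `0` finds the queue empty. This bound is available before the
occupation measure is known to be finite. -/
lemma cycleOccupation_zero_le (ν : Measure (ℕ × ℕ)) [IsProbabilityMeasure ν] :
    cycleOccupation ν {0} ≤ 1 := by
  have := lintegral_cycleOccupation ν (Set.indicator {0} 1)
  rw [lintegral_indicator_one (measurableSet_singleton 0)] at this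
  rw [this, tsum_eq_single 0]
  · refine (setLIntegral_le_lintegral _ _).trans ?_
    refine (lintegral_mono (g := fun _ => 1) fun u => ?_).trans (by simp)
    exact Set.indicator_le_self' (fun _ _ => zero_le) _
  · intro n hn
    rw [← lintegral_indicator (measurableSet_inCycle _)]
    refine (lintegral_congr fun u => ?_).trans lintegral_zero
    by_cases h : InCycle u n
    · rw [Set.indicator_of_mem (show u ∈ {u | InCycle u n} from h), Set.indicator_of_notMem]
      exact h n (Nat.pos_of_ne_zero hn) le_rfl
    · exact Set.indicator_of_notMem (show u ∉ {u | InCycle u n} from h) _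

lemma lindley_mk (w s x : ℕ) : lindley w (s, x) = w + s - (x + 1) := rfl

lemma abs_lindley_sub_le (w s x : ℕ) : |(lindley w (s, x) : ℝ) - w| ≤ s + (x + 1) := by
  rw [lindley_mk, abs_le]
  have h₁ : ((w + s - (x + 1) : ℕ) : ℝ) ≤ w + s := by exact_mod_cast Nat.sub_le _ _
  have h₂ : (w : ℝ) + s ≤ ((w + s - (x + 1) : ℕ) : ℝ) + (x + 1) := by
    exact_mod_cast (by omega : w + s ≤ w + s - (x + 1) + (x + 1))
  have h₃ : (0 : ℝ) ≤ s := s.cast_nonneg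
  have h₄ : (0 : ℝ) ≤ x := x.cast_nonneg
  constructor <;> linarith

lemma lindley_le_add (w s x : ℕ) : (lindley w (s, x) : ℝ) ≤ w + s := by
  rw [lindley_mk]
  exact_mod_cast Nat.sub_le _ _

/-- The law of a service time and of the number of slots between two consecutive arrival slots. -/
noncomputable abbrev stepLaw (σ : Measure ℕ) (p : unitInterval) : Measure (ℕ × ℕ) :=
  σ.prod (geometricMeasure p)

lemma integrable_cast_of_sq {σ : Measure ℕ} [IsProbabilityMeasure σ]
    (hσ : Integrable (fun s : ℕ => (s : ℝ) ^ 2) σ) : Integrable (fun s : ℕ => (s : ℝ)) σ := by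
  refine (hσ.add (integrable_const (1 : ℝ))).mono' (measurable_of_countable _).aestronglyMeasurable
    (Eventually.of_forall fun s => ?_)
  simp only [Real.norm_natCast, Pi.add_apply]
  nlinarith [sq_nonneg ((s : ℝ) - 1), s.cast_nonneg (α := ℝ)]

/-- The dominating function of a step. -/
noncomputable def stepBound (z : ℕ × ℕ) : ℝ := ((z.1 : ℝ) + 1) ^ 2 * ((z.2 : ℝ) + 1) ^ 2

lemma integrable_stepBound {σ : Measure ℕ} [IsProbabilityMeasure σ] {p : unitInterval}
    (hp : p ≠ 0) (hσ : Integrable (fun s : ℕ => (s : ℝ) ^ 2) σ) :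
    Integrable stepBound (stepLaw σ p) := by
  refine Integrable.mul_prod (f := fun s : ℕ => ((s : ℝ) + 1) ^ 2) ?_
    (integrable_geometricMeasure_succ_sq hp)
  refine (hσ.add (((integrable_cast_of_sq hσ).const_mul 2).add (integrable_const 1))).congr
    (Eventually.of_forall fun s => ?_)
  simp only [Pi.add_apply]
  ring

lemma integrable_of_le_stepBound {σ : Measure ℕ} [IsProbabilityMeasure σ] {p : unitInterval}
    (hp : p ≠ 0) (hσ : Integrable (fun s : ℕ => (s : ℝ) ^ 2) σ) {f : ℕ × ℕ → ℝ} (C : ℝ)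
    (hf : ∀ z, |f z| ≤ C * stepBound z) : Integrable f (stepLaw σ p) :=
  ((integrable_stepBound hp hσ).const_mul C).mono' (measurable_of_countable _).aestronglyMeasurable
    (Eventually.of_forall hf)

lemma integral_service_drift {σ : Measure ℕ} [IsProbabilityMeasure σ]
    (hσ : Integrable (fun s : ℕ => (s : ℝ) ^ 2) σ) (w : ℕ) (a b c : ℝ) :
    ∫ s : ℕ, (a * ((w + s : ℕ) : ℝ) ^ 2 + b * ((w + s : ℕ) : ℝ) + c) ∂σ =
      a * ((w : ℝ) ^ 2 + 2 * w * ∫ s : ℕ, (s : ℝ) ∂σ + ∫ s : ℕ, (s : ℝ) ^ 2 ∂σ) +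
        b * (w + ∫ s : ℕ, (s : ℝ) ∂σ) + c := by
  have h1 := integrable_cast_of_sq hσ
  have heq : ∀ s : ℕ, a * ((w + s : ℕ) : ℝ) ^ 2 + b * ((w + s : ℕ) : ℝ) + c =
      a * (s : ℝ) ^ 2 + ((2 * a * w + b) * s + (a * (w : ℝ) ^ 2 + b * w + c)) := fun s => by
    push_cast
    ring
  simp_rw [heq]
  have h2 : Integrable (fun s : ℕ => (2 * a * w + b) * s + (a * (w : ℝ) ^ 2 + b * w + c)) σ :=
    (h1.const_mul _).add (integrable_const _)
  rw [integral_add (hσ.const_mul a) h2,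
    integral_add (h1.const_mul _) (integrable_const _), integral_const_mul, integral_const_mul]
  simp only [integral_const, probReal_univ, smul_eq_mul, one_mul]
  ring

section Stability

variable {σ : Measure ℕ} [IsProbabilityMeasure σ] {p : unitInterval}

/-- The weight `(1 - p) / p` on nonzero states is chosen so that the two terms in `(1 - p) ^ (w +
s)` cancel, which leaves an exact linear drift. -/
lemma integral_step_linear (hp : p ≠ 0)
    (hσ : Integrable (fun s : ℕ => (s : ℝ) ^ 2) σ) (hpos : ∀ᵐ s ∂σ, 1 ≤ s) (w : ℕ) :
    Integrable (fun z => (lindley w z : ℝ) + (1 - p) / p * (if lindley w z = 0 then 0 else 1))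
      (stepLaw σ p) ∧
    ∫ z, ((lindley w z : ℝ) + (1 - p) / p * (if lindley w z = 0 then 0 else 1)) ∂stepLaw σ p =
      w + ∫ s : ℕ, (s : ℝ) ∂σ - 1 := by
  have hp' : (p : ℝ) ≠ 0 := fun h => hp (Subtype.ext h)
  have hp0 : 0 < (p : ℝ) := lt_of_le_of_ne p.2.1 hp'.symm
  have hp1 : (p : ℝ) ≤ 1 := p.2.2
  have hint : Integrable (fun z => (lindley w z : ℝ) +
      (1 - p) / p * (if lindley w z = 0 then 0 else 1)) (stepLaw σ p) := by
    refine integrable_of_le_stepBound hp hσ (w + 1 + 1 / p) fun z => ?_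
    obtain ⟨s, x⟩ := z
    have h₁ := lindley_le_add w s x
    have hs : (0 : ℝ) ≤ s := s.cast_nonneg
    have hx : (0 : ℝ) ≤ x := x.cast_nonneg
    have hw : (0 : ℝ) ≤ w := w.cast_nonneg
    have hq : (0 : ℝ) ≤ (1 - p) / p := div_nonneg (by linarith) hp0.le
    have hq' : (1 - p : ℝ) / p ≤ 1 / p := by gcongr; linarith
    have hite : (0 : ℝ) ≤ (if lindley w (s, x) = 0 then 0 else 1) ∧
        (if lindley w (s, x) = 0 then 0 else 1) ≤ (1 : ℝ) := by
      split_ifs <;> norm_num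
    have hl : (0 : ℝ) ≤ lindley w (s, x) := Nat.cast_nonneg _
    rw [abs_of_nonneg (add_nonneg hl (mul_nonneg hq hite.1))]
    have hB : (s : ℝ) + 1 ≤ stepBound (s, x) := by
      have h1 : (s : ℝ) + 1 ≤ ((s : ℝ) + 1) ^ 2 := by nlinarith
      have h2 : (1 : ℝ) ≤ ((x : ℝ) + 1) ^ 2 := by nlinarith
      calc (s : ℝ) + 1 ≤ ((s : ℝ) + 1) ^ 2 * 1 := by linarith
        _ ≤ _ := by unfold stepBound; gcongr
    have h2 : (1 - p : ℝ) / p * (if lindley w (s, x) = 0 then 0 else 1) ≤ 1 / p := by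
      calc _ ≤ (1 - p : ℝ) / p * 1 := by gcongr; exact hite.2
        _ ≤ _ := by linarith
    have h3 : (0 : ℝ) < 1 / p := by positivity
    calc _ ≤ (w : ℝ) + s + 1 / p := by linarith
      _ ≤ (w + 1 + 1 / p) * ((s : ℝ) + 1) := by nlinarith
      _ ≤ _ := by gcongr
  refine ⟨hint, ?_⟩
  rw [integral_prod _ hint]
  have hin : ∀ᵐ s ∂σ, ∫ x, ((lindley w (s, x) : ℝ) +
      (1 - p) / p * (if lindley w (s, x) = 0 then 0 else 1)) ∂geometricMeasure p =
      0 * ((w + s : ℕ) : ℝ) ^ 2 + 1 * ((w + s : ℕ) : ℝ) + (-1) := by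
    filter_upwards [hpos] with s hs
    -- Positive service times are needed here: the formula for the probability of a nonzero state
    -- holds only for `w + s ≥ 1`.
    obtain ⟨t, ht⟩ : ∃ t, w + s = t + 1 := ⟨w + s - 1, by omega⟩
    simp only [lindley_mk, ht]
    rw [integral_add (integrable_geometricMeasure_sub p (fun k => (k : ℝ)) (t + 1))
      ((integrable_geometricMeasure_sub p (fun k => if k = 0 then (0 : ℝ) else 1)
        (t + 1)).const_mul _), integral_const_mul, integral_geometricMeasure_sub hp,
      integral_geometricMeasure_sub_ne_zero hp]
    push_cast
    field_simp
    ring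
  rw [integral_congr_ae hin, integral_service_drift hσ]
  ring

/-- The exact second moment contains a nonpositive multiple of `(1 - p) ^ (w + s)`, and averaging
over the service adds the negative constant `-(2 / p) * E[S]`; both are dropped. A negative drift
linear in `w` remains. -/
lemma integral_step_sq_le (hp : p ≠ 0)
    (hσ : Integrable (fun s : ℕ => (s : ℝ) ^ 2) σ) (w : ℕ) :
    Integrable (fun z => (lindley w z : ℝ) ^ 2) (stepLaw σ p) ∧
    ∫ z, (lindley w z : ℝ) ^ 2 ∂stepLaw σ p ≤
      (w : ℝ) ^ 2 - 2 * (1 / p - ∫ s : ℕ, (s : ℝ) ∂σ) * w +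
        (∫ s : ℕ, (s : ℝ) ^ 2 ∂σ + (2 - p) / (p : ℝ) ^ 2) := by
  have hp' : (p : ℝ) ≠ 0 := fun h => hp (Subtype.ext h)
  have hp0 : 0 < (p : ℝ) := lt_of_le_of_ne p.2.1 hp'.symm
  have hp1 : (p : ℝ) ≤ 1 := p.2.2
  have hint : Integrable (fun z => (lindley w z : ℝ) ^ 2) (stepLaw σ p) := by
    refine integrable_of_le_stepBound hp hσ ((w + 1) ^ 2) fun z => ?_
    obtain ⟨s, x⟩ := z
    have h₁ := lindley_le_add w s x
    have hs : (0 : ℝ) ≤ s := s.cast_nonneg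
    have hx : (0 : ℝ) ≤ x := x.cast_nonneg
    have hw : (0 : ℝ) ≤ w := w.cast_nonneg
    rw [abs_of_nonneg (sq_nonneg _)]
    have h2 : (1 : ℝ) ≤ ((x : ℝ) + 1) ^ 2 := by nlinarith
    calc (lindley w (s, x) : ℝ) ^ 2 ≤ ((w + 1) * ((s : ℝ) + 1)) ^ 2 := by
          gcongr
          nlinarith
      _ = (w + 1) ^ 2 * (((s : ℝ) + 1) ^ 2 * 1) := by ring
      _ ≤ _ := by unfold stepBound; gcongr
  refine ⟨hint, ?_⟩
  rw [integral_prod _ hint]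
  have hle : ∀ s : ℕ, ∫ x, (lindley w (s, x) : ℝ) ^ 2 ∂geometricMeasure p ≤
      1 * ((w + s : ℕ) : ℝ) ^ 2 + (-2 / p) * ((w + s : ℕ) : ℝ) + (2 - p) / (p : ℝ) ^ 2 := by
    intro s
    simp only [lindley_mk]
    rw [integral_geometricMeasure_sub_sq hp]
    have h₁ : (0 : ℝ) ≤ (1 - p : ℝ) ^ (w + s) := pow_nonneg (by linarith) _
    have h₂ : (0 : ℝ) ≤ (2 - p) / (p : ℝ) ^ 2 := div_nonneg (by linarith) (by positivity)
    have h₃ : 2 * ((w + s : ℕ) : ℝ) / p = -(-2 / p * ((w + s : ℕ) : ℝ)) := by ring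
    nlinarith [mul_nonneg h₂ h₁]
  have h1 := integrable_cast_of_sq hσ
  have hint' : Integrable (fun s : ℕ => 1 * ((w + s : ℕ) : ℝ) ^ 2 +
      (-2 / p) * ((w + s : ℕ) : ℝ) + (2 - p) / (p : ℝ) ^ 2) σ := by
    have heq : (fun s : ℕ => 1 * ((w + s : ℕ) : ℝ) ^ 2 +
        (-2 / p) * ((w + s : ℕ) : ℝ) + (2 - p) / (p : ℝ) ^ 2) = fun s : ℕ => (s : ℝ) ^ 2 +
        ((2 * w - 2 / p) * s + ((w : ℝ) ^ 2 - 2 / p * w + (2 - p) / (p : ℝ) ^ 2)) := by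
      funext s
      push_cast
      ring
    rw [heq]
    exact hσ.add ((h1.const_mul _).add (integrable_const _))
  refine (integral_mono hint.integral_prod_left hint' hle).trans ?_
  rw [integral_service_drift hσ]
  have hES : 0 ≤ ∫ s : ℕ, (s : ℝ) ∂σ := integral_nonneg fun s => s.cast_nonneg
  have : 0 ≤ 2 / (p : ℝ) * ∫ s : ℕ, (s : ℝ) ∂σ := by positivity
  have h4 : (-2 / (p : ℝ)) * ((w : ℝ) + ∫ s : ℕ, (s : ℝ) ∂σ) =
    -(2 * (1 / (p : ℝ)) * w) - 2 / (p : ℝ) * ∫ s : ℕ, (s : ℝ) ∂σ := by ring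
  rw [h4]
  linarith

/-- Foster's criterion with the function of `integral_step_linear`: its drift is exactly `-δ` away
from `0`, and at `0` it exceeds this by `(1 - p) / p`. The excess is charged only to the state `0`,
whose occupation is at most one. -/
theorem isFiniteMeasure_cycleOccupation (hp : p ≠ 0)
    (hσ : Integrable (fun s : ℕ => (s : ℝ) ^ 2) σ) (hpos : ∀ᵐ s ∂σ, 1 ≤ s)
    (hstable : ∫ s : ℕ, (s : ℝ) ∂σ < 1 / p) :
    IsFiniteMeasure (cycleOccupation (stepLaw σ p)) := by
  have hp' : (p : ℝ) ≠ 0 := fun h => hp (Subtype.ext h)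
  have hp0 : 0 < (p : ℝ) := lt_of_le_of_ne p.2.1 hp'.symm
  have hp1 : (p : ℝ) ≤ 1 := p.2.2
  have hq : (0 : ℝ) ≤ (1 - p) / p := div_nonneg (by linarith) hp0.le
  set g : ℕ → ℝ := fun w => w + (1 - p) / p * (if w = 0 then 0 else 1) with hg
  have hg0 : ∀ w, 0 ≤ g w := fun w => by
    have : (0 : ℝ) ≤ (if w = 0 then 0 else 1) := by split_ifs <;> norm_num
    exact add_nonneg w.cast_nonneg (mul_nonneg hq this)
  have hES : 1 ≤ ∫ s : ℕ, (s : ℝ) ∂σ := by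
    have := integral_mono_ae (integrable_const (1 : ℝ)) (integrable_cast_of_sq hσ)
      (hpos.mono fun s hs => Nat.one_le_cast.2 hs)
    simpa using this
  set δ : ℝ := 1 / p - ∫ s : ℕ, (s : ℝ) ∂σ with hδ
  have hδ0 : 0 < δ := sub_pos.2 hstable
  have hfoster := lintegral_cycleOccupation_le (stepLaw σ p) (g := fun w => ENNReal.ofReal (g w))
    (c := fun _ => ENNReal.ofReal δ)
    (b := Set.indicator {0} fun _ => ENNReal.ofReal ((1 - p) / p)) (by simp [hg]) fun w => ?_
  · rw [lintegral_const, lintegral_indicator_const (measurableSet_singleton 0)] at hfoster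
    constructor
    have h1 : ENNReal.ofReal ((1 - p) / p) * cycleOccupation (stepLaw σ p) {0} < ⊤ :=
      ENNReal.mul_lt_top ENNReal.ofReal_lt_top
        ((cycleOccupation_zero_le _).trans_lt ENNReal.one_lt_top)
    by_contra htop
    rw [not_lt, top_le_iff] at htop
    rw [htop, ENNReal.mul_top (by simpa using hδ0)] at hfoster
    exact (h1.trans_le hfoster).ne rfl
  · obtain ⟨hint, hval⟩ := integral_step_linear hp hσ hpos w
    have hnn : 0 ≤ (w : ℝ) + ∫ s : ℕ, (s : ℝ) ∂σ - 1 := by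
      have : (0 : ℝ) ≤ w := w.cast_nonneg
      linarith
    have hlin : ∫⁻ z, ENNReal.ofReal (g (lindley w z)) ∂stepLaw σ p =
        ENNReal.ofReal (w + ∫ s : ℕ, (s : ℝ) ∂σ - 1) := by
      rw [← hval, ofReal_integral_eq_lintegral_ofReal hint (Eventually.of_forall fun z => hg0 _)]
    rw [hlin, ← ENNReal.ofReal_add hnn hδ0.le]
    rcases eq_or_ne w 0 with rfl | hw
    · rw [Set.indicator_of_mem (Set.mem_singleton 0), ← ENNReal.ofReal_add (hg0 _) hq]
      refine ENNReal.ofReal_le_ofReal (le_of_eq ?_)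
      simp only [hδ, hg, Nat.cast_zero, if_true]
      field_simp
      ring
    · rw [Set.indicator_of_notMem (by simpa using hw), add_zero]
      refine ENNReal.ofReal_le_ofReal (le_of_eq ?_)
      simp only [hδ, hg, if_neg hw]
      field_simp
      ring

/-- Foster's bound for `w ^ 2`, whose drift is at most `-2 δ w + K`. The constant `K` has a finite
integral because the occupation measure is finite. -/
theorem integrable_cycleOccupation (hp : p ≠ 0)
    (hσ : Integrable (fun s : ℕ => (s : ℝ) ^ 2) σ)
    (hstable : ∫ s : ℕ, (s : ℝ) ∂σ < 1 / p) [IsFiniteMeasure (cycleOccupation (stepLaw σ p))] :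
    Integrable (fun w : ℕ => (w : ℝ)) (cycleOccupation (stepLaw σ p)) := by
  have hp' : (p : ℝ) ≠ 0 := fun h => hp (Subtype.ext h)
  have hp0 : 0 < (p : ℝ) := lt_of_le_of_ne p.2.1 hp'.symm
  have hp1 : (p : ℝ) ≤ 1 := p.2.2
  set δ : ℝ := 1 / p - ∫ s : ℕ, (s : ℝ) ∂σ with hδ
  have hδ0 : 0 < δ := sub_pos.2 hstable
  set K : ℝ := ∫ s : ℕ, (s : ℝ) ^ 2 ∂σ + (2 - p) / (p : ℝ) ^ 2 with hK
  have hK0 : 0 ≤ K := add_nonneg (integral_nonneg fun s => sq_nonneg _)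
    (div_nonneg (by linarith) (by positivity))
  have hfoster := lintegral_cycleOccupation_le (stepLaw σ p)
    (g := fun w => ENNReal.ofReal ((w : ℝ) ^ 2))
    (c := fun w => ENNReal.ofReal (2 * δ * w)) (b := fun _ => ENNReal.ofReal K) (by simp)
    fun w => ?_
  · rw [lintegral_const] at hfoster
    have hfin : ∫⁻ w : ℕ, ENNReal.ofReal (2 * δ * w) ∂cycleOccupation (stepLaw σ p) < ⊤ :=
      hfoster.trans_lt (ENNReal.mul_lt_top ENNReal.ofReal_lt_top (measure_lt_top _ _))
    have hint : Integrable (fun w : ℕ => 2 * δ * (w : ℝ)) (cycleOccupation (stepLaw σ p)) := by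
      refine ⟨(measurable_of_countable _).aestronglyMeasurable, ?_⟩
      rwa [hasFiniteIntegral_iff_ofReal (Eventually.of_forall fun w => by positivity)]
    refine (hint.const_mul (2 * δ)⁻¹).congr (Eventually.of_forall fun w => ?_)
    have : 2 * δ ≠ 0 := by positivity
    field_simp
  · obtain ⟨hint, hle⟩ := integral_step_sq_le hp hσ w
    have hw : (0 : ℝ) ≤ w := w.cast_nonneg
    rw [← ofReal_integral_eq_lintegral_ofReal hint (Eventually.of_forall fun z => sq_nonneg _),
      ← ENNReal.ofReal_add (integral_nonneg fun z => sq_nonneg _) (by positivity),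
      ← ENNReal.ofReal_add (sq_nonneg _) hK0]
    refine ENNReal.ofReal_le_ofReal ?_
    linarith

end Stability

/-! ### Stationary means from vanishing drifts. -/

/-- Factoring the difference of squares bounds one factor by the step alone, so the bound is linear
in `w`. A first moment of the waiting time is then enough. -/
lemma abs_lindley_sq_sub_le (w s x : ℕ) :
    |(lindley w (s, x) : ℝ) ^ 2 - (w : ℝ) ^ 2| ≤ 2 * (((w : ℝ) + 1) * stepBound (s, x)) := by
  have h₁ := abs_lindley_sub_le w s x
  have h₂ := lindley_le_add w s x
  have h₃ : (0 : ℝ) ≤ lindley w (s, x) := Nat.cast_nonneg _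
  have hw : (0 : ℝ) ≤ w := w.cast_nonneg
  have hs : (0 : ℝ) ≤ s := s.cast_nonneg
  have hx : (0 : ℝ) ≤ x := x.cast_nonneg
  rw [sq_sub_sq, abs_mul, abs_of_nonneg (add_nonneg h₃ hw)]
  calc _ ≤ (2 * ((w : ℝ) + 1) * (s + 1)) * (((s : ℝ) + 1) * (x + 1) ^ 2) := by
        refine mul_le_mul ?_ (h₁.trans ?_) (abs_nonneg _) (by positivity)
        · nlinarith
        · nlinarith [mul_nonneg hs hx, mul_nonneg hs (mul_nonneg hx hx)]
    _ = _ := by unfold stepBound; ring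

lemma one_le_stepBound (z : ℕ × ℕ) : 1 ≤ stepBound z := by
  have h₁ : (0 : ℝ) ≤ z.1 := Nat.cast_nonneg _
  have h₂ : (0 : ℝ) ≤ z.2 := Nat.cast_nonneg _
  exact one_le_mul_of_one_le_of_one_le (one_le_pow₀ (by linarith)) (one_le_pow₀ (by linarith))

lemma abs_succ_mul_lindley_le (w s x : ℕ) :
    |((x : ℝ) + 1) * lindley w (s, x)| ≤ 1 * (((w : ℝ) + 1) * stepBound (s, x)) := by
  have h₁ : (0 : ℝ) ≤ s := s.cast_nonneg
  have h₂ : (0 : ℝ) ≤ x := x.cast_nonneg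
  have h₃ : (0 : ℝ) ≤ w := w.cast_nonneg
  have h₄ := lindley_le_add w s x
  have h₅ : (0 : ℝ) ≤ lindley w (s, x) := Nat.cast_nonneg _
  rw [abs_of_nonneg (by positivity), one_mul]
  calc ((x : ℝ) + 1) * lindley w (s, x) ≤ ((x : ℝ) + 1) ^ 2 * (((w : ℝ) + 1) * (s + 1) ^ 2) := by
        gcongr
        · nlinarith
        · nlinarith [mul_nonneg h₃ h₁, mul_nonneg h₃ (sq_nonneg (s : ℝ))]
    _ = _ := by unfold stepBound; ring

section Stationary

variable {σ : Measure ℕ} [IsProbabilityMeasure σ] {p : unitInterval}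

lemma integrable_stationary_prod
    [IsFiniteMeasure (cycleOccupation (stepLaw σ p))] (hp : p ≠ 0)
    (hσ : Integrable (fun s : ℕ => (s : ℝ) ^ 2) σ)
    (hw : Integrable (fun w : ℕ => (w : ℝ)) (stationaryWaiting (stepLaw σ p)))
    {F : ℕ × (ℕ × ℕ) → ℝ} (C : ℝ) (hF : ∀ w z, |F (w, z)| ≤ C * (((w : ℝ) + 1) * stepBound z)) :
    Integrable F ((stationaryWaiting (stepLaw σ p)).prod (stepLaw σ p)) := by
  have := isProbabilityMeasure_stationaryWaiting (stepLaw σ p)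
  have h1 : Integrable (fun w : ℕ => (w : ℝ) + 1) (stationaryWaiting (stepLaw σ p)) :=
    hw.add (integrable_const _)
  exact ((h1.mul_prod (integrable_stepBound hp hσ)).const_mul C).mono'
    (measurable_of_countable _).aestronglyMeasurable (Eventually.of_forall fun q => hF q.1 q.2)

lemma integral_stationary_prod
    [IsFiniteMeasure (cycleOccupation (stepLaw σ p))]
    {F : ℕ × (ℕ × ℕ) → ℝ} (hF : Integrable F ((stationaryWaiting (stepLaw σ p)).prod (stepLaw σ p)))
    {f : ℕ → ℝ} (hf : ∀ w, ∫ s, ∫ x, F (w, (s, x)) ∂geometricMeasure p ∂σ = f w) :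
    ∫ q, F q ∂(stationaryWaiting (stepLaw σ p)).prod (stepLaw σ p) =
      ∫ w, f w ∂stationaryWaiting (stepLaw σ p) := by
  have := isProbabilityMeasure_stationaryWaiting (stepLaw σ p)
  rw [integral_prod _ hF]
  refine integral_congr_ae ?_
  filter_upwards [hF.prod_right_ae] with w hw
  rw [← hf w, integral_prod _ hw]

/-- The stationary mean waiting time, the stationary mean of `X W`, where `X` is the time between
the arrivals of a packet and of its predecessor and `W` is its waiting time, and the integrability
behind them. -/
theorem stationaryWaiting_means (hp : p ≠ 0)
    (hσ : Integrable (fun s : ℕ => (s : ℝ) ^ 2) σ) (hpos : ∀ᵐ s ∂σ, 1 ≤ s)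
    (hstable : ∫ s : ℕ, (s : ℝ) ∂σ < 1 / p) [IsFiniteMeasure (cycleOccupation (stepLaw σ p))]
    (hw : Integrable (fun w : ℕ => (w : ℝ)) (stationaryWaiting (stepLaw σ p))) :
    ∫ w : ℕ, (w : ℝ) ∂stationaryWaiting (stepLaw σ p) =
      (p * ∫ s : ℕ, (s : ℝ) ^ 2 ∂σ - p * ∫ s : ℕ, (s : ℝ) ∂σ) /
        (2 * (1 - p * ∫ s : ℕ, (s : ℝ) ∂σ)) ∧
    p * ∫ q : ℕ × (ℕ × ℕ), ((q.2.2 : ℝ) + 1) * lindley q.1 q.2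
        ∂(stationaryWaiting (stepLaw σ p)).prod (stepLaw σ p) =
      ∫ w : ℕ, (w : ℝ) ∂stationaryWaiting (stepLaw σ p) +
        (1 - p) / p * ((1 - p * ∫ s : ℕ, (s : ℝ) ∂σ) / (∫ s : ℕ, (1 - p : ℝ) ^ s ∂σ) - 1) := by
  have hp' : (p : ℝ) ≠ 0 := fun h => hp (Subtype.ext h)
  have hp0 : 0 < (p : ℝ) := lt_of_le_of_ne p.2.1 hp'.symm
  have hprob := isProbabilityMeasure_stationaryWaiting (stepLaw σ p)
  have hs := integrable_cast_of_sq hσ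
  have hES : 1 ≤ ∫ s : ℕ, (s : ℝ) ∂σ := by
    have := integral_mono_ae (integrable_const (1 : ℝ)) hs
      (hpos.mono fun s hs => Nat.one_le_cast.2 hs)
    simpa using this
  -- A load below one with services of at least one slot forces `p < 1`, so `q` is positive and can
  -- be divided by.
  have hp1 : (p : ℝ) < 1 := by
    rw [lt_div_iff₀ hp0] at hstable
    nlinarith
  have hρ : 0 < 1 - p * ∫ s : ℕ, (s : ℝ) ∂σ := by
    rw [lt_div_iff₀ hp0] at hstable
    linarith
  have hq0 : (0 : ℝ) < 1 - p := by linarith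
  have hq1 : (1 - p : ℝ) ≤ 1 := by linarith
  set π := stationaryWaiting (stepLaw σ p) with hπ
  set q : ℝ := 1 - p with hq
  have hqpow : ∀ k : ℕ, 0 ≤ q ^ k ∧ q ^ k ≤ 1 := fun k =>
    ⟨pow_nonneg hq0.le k, pow_le_one₀ hq0.le hq1⟩
  have hbdd : ∀ (m : Measure ℕ) [IsProbabilityMeasure m], Integrable (fun k : ℕ => q ^ k) m := by
    intro m _
    refine Integrable.of_bound (measurable_of_countable _).aestronglyMeasurable 1
      (Eventually.of_forall fun k => ?_)
    rw [Real.norm_eq_abs, abs_of_nonneg (hqpow k).1]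
    exact (hqpow k).2
  have hmul : ∀ (m : Measure ℕ) [IsProbabilityMeasure m], Integrable (fun k : ℕ => (k : ℝ)) m →
      Integrable (fun k : ℕ => (k : ℝ) * q ^ k) m := by
    intro m _ hm
    refine hm.mul_bdd (c := 1) (measurable_of_countable _).aestronglyMeasurable
      (Eventually.of_forall fun k => ?_)
    rw [Real.norm_eq_abs, abs_of_nonneg (hqpow k).1]
    exact (hqpow k).2
  set M := ∫ s : ℕ, (s : ℝ) ∂σ with hM
  set M₂ := ∫ s : ℕ, (s : ℝ) ^ 2 ∂σ with hM₂
  set L := ∫ s : ℕ, q ^ s ∂σ with hL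
  set L' := ∫ s : ℕ, (s : ℝ) * q ^ s ∂σ with hL'
  set v := ∫ w : ℕ, (w : ℝ) ∂π with hv
  set φ := ∫ w : ℕ, q ^ w ∂π with hφ
  set ψ := ∫ w : ℕ, (w : ℝ) * q ^ w ∂π with hψ
  have hLpos : 0 < L := by
    rw [hL, integral_pos_iff_support_of_nonneg (fun s => (hqpow s).1) (hbdd σ)]
    have : Function.support (fun s : ℕ => q ^ s) = Set.univ :=
      Function.support_eq_univ fun s => (pow_pos hq0 s).ne'
    rw [this, measure_univ]
    exact one_pos
  -- integrals of linear combinations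
  have hcomb : ∀ (m : Measure ℕ) [IsProbabilityMeasure m], Integrable (fun k : ℕ => (k : ℝ)) m →
      ∀ a b c d : ℝ, ∫ k : ℕ, (a * ((k : ℝ) * q ^ k) + (b * q ^ k + (c * k + d))) ∂m =
        a * ∫ k : ℕ, (k : ℝ) * q ^ k ∂m + (b * ∫ k : ℕ, q ^ k ∂m + (c * ∫ k : ℕ, (k : ℝ) ∂m + d)) := by
    intro m _ hm a b c d
    have i₁ : Integrable (fun k : ℕ => c * (k : ℝ) + d) m := (hm.const_mul c).add (integrable_const d)
    have i₂ : Integrable (fun k : ℕ => b * q ^ k + (c * (k : ℝ) + d)) m :=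
      ((hbdd m).const_mul b).add i₁
    rw [integral_add ((hmul m hm).const_mul a) i₂, integral_add ((hbdd m).const_mul b) i₁,
      integral_add (hm.const_mul c) (integrable_const d), integral_const_mul, integral_const_mul,
      integral_const_mul]
    simp
  -- the increment of the identity
  have e₁ : M - 1 / p + φ * L / p = 0 := by
    have hint : Integrable (fun r : ℕ × (ℕ × ℕ) => (lindley r.1 r.2 : ℝ) - r.1)
        (π.prod (stepLaw σ p)) := by
      refine integrable_stationary_prod hp hσ hw 1 fun w ⟨s, x⟩ => ?_
      refine (abs_lindley_sub_le w s x).trans ?_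
      have h₁ : (0 : ℝ) ≤ s := s.cast_nonneg
      have h₂ : (0 : ℝ) ≤ x := x.cast_nonneg
      have h₃ : (0 : ℝ) ≤ w := w.cast_nonneg
      have h₄ : (s : ℝ) + (x + 1) ≤ stepBound (s, x) := by
        unfold stepBound
        simp only
        nlinarith [mul_nonneg h₁ h₂, mul_nonneg (sq_nonneg (s : ℝ)) (sq_nonneg (x : ℝ)),
          mul_nonneg (sq_nonneg (s : ℝ)) h₂, mul_nonneg h₁ (sq_nonneg (x : ℝ)),
          sq_nonneg (s : ℝ), sq_nonneg (x : ℝ)]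
      nlinarith [one_le_stepBound (s, x)]
    have h0 := integral_increment_eq_zero (stepLaw σ p) (fun w => (w : ℝ)) hint
    -- The drift at `w`, averaged over service and gap, is written in the span of `w * q ^ w`, `q ^
    -- w`, `w` and `1`, which `hcomb` integrates; the same form recurs in the equations below.
    rw [integral_stationary_prod hint (f := fun w => 0 * ((w : ℝ) * q ^ w) +
      (L / p * q ^ w + (0 * w + (M - 1 / p)))) fun w => ?_, hcomb π hw] at h0
    · rw [← h0]
      ring
    · have hin : ∀ s : ℕ, ∫ x : ℕ, ((lindley w (s, x) : ℝ) - w) ∂geometricMeasure p =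
          0 * ((s : ℝ) * q ^ s) + (q ^ w / p * q ^ s + (1 * s + (-1 / p))) := by
        intro s
        simp only [lindley_mk]
        rw [integral_sub (integrable_geometricMeasure_sub p (fun k => (k : ℝ)) (w + s))
          (integrable_const _), integral_geometricMeasure_sub hp]
        simp only [integral_const, probReal_univ, smul_eq_mul, one_mul, pow_add, ← hq]
        push_cast
        ring
      simp_rw [hin]
      rw [hcomb σ hs]
      ring
  -- the increment of the square
  have e₂ : 2 * M * v + M₂ - 2 / p * (v + M) + (2 - p) / (p : ℝ) ^ 2 * (1 - φ * L) = 0 := by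
    have hint : Integrable (fun r : ℕ × (ℕ × ℕ) => (lindley r.1 r.2 : ℝ) ^ 2 - (r.1 : ℝ) ^ 2)
        (π.prod (stepLaw σ p)) :=
      integrable_stationary_prod hp hσ hw 2 fun w ⟨s, x⟩ => abs_lindley_sq_sub_le w s x
    have h0 := integral_increment_eq_zero (stepLaw σ p) (fun w => (w : ℝ) ^ 2) hint
    rw [integral_stationary_prod hint (f := fun w => 0 * ((w : ℝ) * q ^ w) +
      (-((2 - p) / (p : ℝ) ^ 2 * L) * q ^ w + ((2 * M - 2 / p) * w +
        (M₂ - 2 / p * M + (2 - p) / (p : ℝ) ^ 2)))) fun w => ?_, hcomb π hw] at h0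
    · rw [← h0]
      ring
    · have hin : ∀ s : ℕ, ∫ x : ℕ, ((lindley w (s, x) : ℝ) ^ 2 - (w : ℝ) ^ 2) ∂geometricMeasure p =
          (s : ℝ) ^ 2 + (0 * ((s : ℝ) * q ^ s) + (-((2 - p) / (p : ℝ) ^ 2 * q ^ w) * q ^ s +
            ((2 * w - 2 / p) * s + (-2 / p * w + (2 - p) / (p : ℝ) ^ 2)))) := by
        intro s
        simp only [lindley_mk]
        rw [integral_sub (integrable_geometricMeasure_sub p (fun k => (k : ℝ) ^ 2) (w + s))
          (integrable_const _), integral_geometricMeasure_sub_sq hp]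
        simp only [integral_const, probReal_univ, smul_eq_mul, one_mul, pow_add, ← hq]
        push_cast
        ring
      simp_rw [hin]
      rw [integral_add hσ, hcomb σ hs]
      · ring
      · exact ((hmul σ hs).const_mul _).add (((hbdd σ).const_mul _).add
          ((hs.const_mul _).add (integrable_const _)))
  -- the increment of the geometric function
  have e₃ : p * (ψ * L + φ * L') + q * φ * L - q * φ = 0 := by
    have hint : Integrable (fun r : ℕ × (ℕ × ℕ) => q ^ lindley r.1 r.2 - q ^ r.1)
        (π.prod (stepLaw σ p)) := by
      refine integrable_stationary_prod hp hσ hw 1 fun w z => ?_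
      have h₁ := hqpow (lindley w z)
      have h₂ := hqpow w
      have h₃ := one_le_stepBound z
      have h₄ : (0 : ℝ) ≤ w := w.cast_nonneg
      rw [abs_le]
      constructor <;> nlinarith
    have h0 := integral_increment_eq_zero (stepLaw σ p) (fun w => q ^ w) hint
    rw [integral_stationary_prod hint (f := fun w => p * L / q * ((w : ℝ) * q ^ w) +
      (((p * L' + q * L - q) / q) * q ^ w + (0 * w + 0))) fun w => ?_, hcomb π hw] at h0
    · have h1 : q * (p * L / q * ψ + ((p * L' + q * L - q) / q * φ + (0 * v + 0))) =
          p * (ψ * L + φ * L') + q * φ * L - q * φ := by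
        field_simp
        ring
      rw [← h1]
      exact mul_eq_zero_of_right q h0
    · have hin : ∀ s : ℕ, ∫ x : ℕ, (q ^ lindley w (s, x) - q ^ w) ∂geometricMeasure p =
          p * q ^ w / q * ((s : ℝ) * q ^ s) + ((p * w + q) * q ^ w / q * q ^ s +
            (0 * s + (-q ^ w))) := by
        intro s
        simp only [lindley_mk]
        have h := integral_geometricMeasure_pow_sub hp (w + s)
        rw [← hq] at h
        rw [integral_sub (integrable_geometricMeasure_sub p (fun k => q ^ k) (w + s))
          (integrable_const _)]
        simp only [integral_const, probReal_univ, smul_eq_mul, one_mul]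
        rw [eq_div_of_mul_eq hq0.ne' ((mul_comm _ _).trans h), pow_add]
        push_cast
        ring
      simp_rw [hin]
      rw [hcomb σ hs]
      field_simp
      ring
  -- The unknowns `ψ` and `L'` enter only through `ψ * L + φ * L'`, the mean of `(W + S) * q ^ (W +
  -- S)`, which `e₃` determines.
  have e₄ : ∫ r : ℕ × (ℕ × ℕ), ((r.2.2 : ℝ) + 1) * lindley r.1 r.2 ∂π.prod (stepLaw σ p) =
      (v + M) / p - (2 - p) / (p : ℝ) ^ 2 * (1 - φ * L) + (ψ * L + φ * L') / p := by
    have hint : Integrable (fun r : ℕ × (ℕ × ℕ) => ((r.2.2 : ℝ) + 1) * lindley r.1 r.2)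
        (π.prod (stepLaw σ p)) := 
      integrable_stationary_prod hp hσ hw 1 fun w ⟨s, x⟩ => abs_succ_mul_lindley_le w s x
    rw [integral_stationary_prod hint (f := fun w => L / p * ((w : ℝ) * q ^ w) +
      (((2 - p) / (p : ℝ) ^ 2 * L + L' / p) * q ^ w + (1 / p * w +
        (M / p - (2 - p) / (p : ℝ) ^ 2)))) fun w => ?_, hcomb π hw]
    · ring
    · have hin : ∀ s : ℕ, ∫ x : ℕ, ((x : ℝ) + 1) * lindley w (s, x) ∂geometricMeasure p =
          q ^ w / p * ((s : ℝ) * q ^ s) + (((2 - p) / (p : ℝ) ^ 2 + w / p) * q ^ w * q ^ s +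
            (1 / p * s + (w / p - (2 - p) / (p : ℝ) ^ 2))) := by
        intro s
        simp only [lindley_mk]
        rw [integral_geometricMeasure_succ_mul_sub hp, ← hq, pow_add]
        push_cast
        ring
      simp_rw [hin]
      rw [hcomb σ hs]
      ring
  have hφL : φ * L = 1 - p * M := by
    field_simp at e₁
    linarith
  have hφ' : φ = (1 - p * M) / L := by
    rw [eq_div_iff hLpos.ne', hφL]
  constructor
  · rw [eq_div_iff (by positivity)]
    rw [hφL] at e₂
    field_simp at e₂
    have : (p : ℝ) * (v * (2 * (1 - p * M)) - (p * M₂ - p * M)) = 0 := by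
      linear_combination (-1 : ℝ) * e₂
    rcases mul_eq_zero.1 this with h | h
    · exact absurd h hp'
    · linarith
  · rw [e₄, ← hφ', hφL]
    have h3 : p * (ψ * L + φ * L') = q * φ - q * (1 - p * M) := by
      rw [← hφL]
      linarith
    have h4 : (ψ * L + φ * L') = (q * φ - q * (1 - p * M)) / p := by
      rw [eq_div_iff hp']
      linarith
    rw [h4, hq]
    field_simp
    ring

end Stationary

/-- The long-run averages of the waiting times in a stable queue. -/
theorem tendsto_waiting_averages {σ : Measure ℕ} [IsProbabilityMeasure σ] {p : unitInterval}
    (hp : p ≠ 0) (hσ : Integrable (fun s : ℕ => (s : ℝ) ^ 2) σ) (hpos : ∀ᵐ s ∂σ, 1 ≤ s)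
    (hstable : ∫ s : ℕ, (s : ℝ) ∂σ < 1 / p) :
    ∃ v c : ℝ,
      v = (p * ∫ s : ℕ, (s : ℝ) ^ 2 ∂σ - p * ∫ s : ℕ, (s : ℝ) ∂σ) /
        (2 * (1 - p * ∫ s : ℕ, (s : ℝ) ∂σ)) ∧
      p * c = v + (1 - p) / p *
        ((1 - p * ∫ s : ℕ, (s : ℝ) ∂σ) / (∫ s : ℕ, (1 - p : ℝ) ^ s ∂σ) - 1) ∧
      ∀ᵐ u ∂iidMeasure (stepLaw σ p),
        Tendsto (fun n : ℕ => (∑ i ∈ Finset.range n, (waiting u i : ℝ)) / n) atTop (nhds v) ∧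
        Tendsto (fun n : ℕ => (∑ i ∈ Finset.range n, (((u i).2 : ℝ) + 1) * waiting u (i + 1)) / n)
          atTop (nhds c) ∧
        Tendsto (fun n : ℕ => (waiting u n : ℝ) ^ 2 / n) atTop (nhds 0) := by
  have hfin := isFiniteMeasure_cycleOccupation hp hσ hpos hstable
  have hprob := isProbabilityMeasure_stationaryWaiting (stepLaw σ p)
  have hw : Integrable (fun w : ℕ => (w : ℝ)) (stationaryWaiting (stepLaw σ p)) :=
    (integrable_cycleOccupation hp hσ hstable).smul_measure
      (ENNReal.inv_ne_top.2 (one_pos.trans_le (one_le_cycleOccupation_univ _)).ne')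
  obtain ⟨hv, hc⟩ := stationaryWaiting_means hp hσ hpos hstable hw
  refine ⟨_, _, hv, hc.trans (by rw [hv]), ?_⟩
  have hsq : Integrable (fun r : ℕ × (ℕ × ℕ) => (lindley r.1 r.2 : ℝ) ^ 2 - (r.1 : ℝ) ^ 2)
      ((stationaryWaiting (stepLaw σ p)).prod (stepLaw σ p)) :=
    integrable_stationary_prod hp hσ hw 2 fun w ⟨s, x⟩ => abs_lindley_sq_sub_le w s x
  have hmul : Integrable (fun r : ℕ × (ℕ × ℕ) => ((r.2.2 : ℝ) + 1) * lindley r.1 r.2)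
      ((stationaryWaiting (stepLaw σ p)).prod (stepLaw σ p)) :=
    integrable_stationary_prod hp hσ hw 1 fun w ⟨s, x⟩ => abs_succ_mul_lindley_le w s x
  have hw' : Integrable (fun r : ℕ × (ℕ × ℕ) => (r.1 : ℝ))
      ((stationaryWaiting (stepLaw σ p)).prod (stepLaw σ p)) := hw.comp_fst _
  have hmean : ∫ r : ℕ × (ℕ × ℕ), (r.1 : ℝ) ∂(stationaryWaiting (stepLaw σ p)).prod (stepLaw σ p) =
      ∫ w : ℕ, (w : ℝ) ∂stationaryWaiting (stepLaw σ p) :=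
    integral_stationary_prod hw' fun w => by simp
  filter_upwards [tendsto_waiting_average _ hw', tendsto_waiting_average _ hmul,
    tendsto_waiting_average _ hsq] with u h₁ h₂ h₃
  rw [hmean] at h₁
  -- The increments of the square sum to the square of the current waiting time. Their average tends
  -- to the mean increment, zero, so this square is `o(n)`.
  rw [integral_increment_eq_zero (stepLaw σ p) (fun w => (w : ℝ) ^ 2) hsq] at h₃
  refine ⟨h₁, h₂, h₃.congr fun n => ?_⟩
  have := Finset.sum_range_sub (fun i => (waiting u i : ℝ) ^ 2) n
  simp only [waiting, Nat.cast_zero, ne_eq, OfNat.ofNat_ne_zero, not_false_eq_true, zero_pow,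
    sub_zero] at this
  rw [this]

/-! ### The gaps between the arrivals -/

/-- The number of slots up to and including the first arrival, or `0` if there is no arrival. -/
noncomputable def trialTime (b : ℕ → Bool) : ℕ := sInf {n | 0 < n ∧ b (n - 1) = true}

lemma trialTime_eq_succ_iff (b : ℕ → Bool) (k : ℕ) :
    trialTime b = k + 1 ↔ (∀ i < k, b i = false) ∧ b k = true := by
  constructor
  · intro h
    have hmem := Nat.sInf_mem (Nat.nonempty_of_sInf_eq_succ h)
    change 0 < trialTime b ∧ b (trialTime b - 1) = true at hmem
    rw [h] at hmem
    refine ⟨fun i hi => ?_, hmem.2⟩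
    by_contra hb
    have : trialTime b ≤ i + 1 := Nat.sInf_le ⟨i.succ_pos, by simpa using hb⟩
    omega
  · rintro ⟨h₁, h₂⟩
    refine le_antisymm (Nat.sInf_le ⟨k.succ_pos, h₂⟩) (le_csInf ⟨k + 1, k.succ_pos, h₂⟩ ?_)
    rintro n ⟨hn, hn'⟩
    by_contra hlt
    have := h₁ (n - 1) (by omega)
    rw [this] at hn'
    exact Bool.false_ne_true hn'

lemma trialTime_dependence {k : ℕ} (hk : 0 < k) {b c : ℕ → Bool} (h : ∀ i < k, b i = c i)
    (hb : trialTime b = k) : trialTime c = k := by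
  obtain ⟨k, rfl⟩ := Nat.exists_eq_succ_of_ne_zero hk.ne'
  rw [Nat.succ_eq_add_one, trialTime_eq_succ_iff] at hb ⊢
  exact ⟨fun i hi => (h i (by omega)).symm.trans (hb.1 i hi),
    (h k (by omega)).symm.trans hb.2⟩

lemma trialTime_eq_succ_set (k : ℕ) : {b : ℕ → Bool | trialTime b = k + 1} =
    ((Finset.range (k + 1) : Finset ℕ) : Set ℕ).pi fun i => if i < k then {false} else {true} := by
  ext b
  simp only [Set.mem_ofPred_eq, trialTime_eq_succ_iff, Set.mem_pi, Finset.mem_coe,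
    Finset.mem_range]
  constructor
  · rintro ⟨h₁, h₂⟩ i hi
    split_ifs with hik
    · exact h₁ i hik
    · rw [show i = k by omega]
      exact h₂
  · intro h
    refine ⟨fun i hi => ?_, ?_⟩
    · simpa [hi] using h i (by omega)
    · simpa using h k (by omega)

lemma measurable_trialTime : Measurable trialTime := by
  have hpos : ∀ k, MeasurableSet (trialTime ⁻¹' {k + 1}) := by
    intro k
    change MeasurableSet {b | trialTime b = k + 1}
    rw [trialTime_eq_succ_set]
    exact .pi (Finset.countable_toSet _) fun i _ => by split_ifs <;> exact measurableSet_singleton _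
  refine measurable_to_countable' fun k => ?_
  cases k with
  | zero =>
    have : trialTime ⁻¹' {0} = (⋃ k, trialTime ⁻¹' {k + 1})ᶜ := by
      ext b
      simp only [Set.mem_preimage, Set.mem_singleton_iff, Set.mem_compl_iff, Set.mem_iUnion]
      exact ⟨fun h ⟨i, hi⟩ => by omega,
        fun h => by_contra fun h' => h ⟨trialTime b - 1, by omega⟩⟩
    rw [this]
    exact (MeasurableSet.iUnion hpos).compl
  | succ k => exact hpos k

lemma measure_trialTime_eq_succ {β : Measure Bool} [IsProbabilityMeasure β] {p : unitInterval}
    (hp : p ≠ 0) (hβ : β.real {true} = p) (k : ℕ) :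
    iidMeasure β {b | trialTime b = k + 1} = geometricMeasure p {k} := by
  have htrue : β {true} = ENNReal.ofReal p := by
    rw [← hβ, measureReal_def, ENNReal.ofReal_toReal (measure_ne_top _ _)]
  have hfalse : β {false} = ENNReal.ofReal (1 - p) := by
    have : ({false} : Set Bool) = {true}ᶜ := by ext b; cases b <;> simp
    rw [this, ← hβ, ← probReal_compl_eq_one_sub (measurableSet_singleton _), measureReal_def,
      ENNReal.ofReal_toReal (measure_ne_top _ _)]
  have hq : (0 : ℝ) ≤ 1 - p := sub_nonneg.2 p.2.2
  rw [trialTime_eq_succ_set, Measure.infinitePi_pi _ fun i _ => by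
    split_ifs <;> exact measurableSet_singleton _, Finset.prod_range_succ, if_neg (lt_irrefl k),
    geometricMeasure_singleton hp, htrue, ENNReal.ofReal_mul (pow_nonneg hq k),
    ENNReal.ofReal_pow hq]
  congr 1
  rw [Finset.prod_congr rfl (g := fun _ => ENNReal.ofReal (1 - p : ℝ)) fun i hi => by
    rw [if_pos (Finset.mem_range.1 hi), hfalse]]
  simp

lemma ae_trialTime_pos {β : Measure Bool} [IsProbabilityMeasure β] {p : unitInterval}
    (hp : p ≠ 0) (hβ : β.real {true} = p) : ∀ᵐ b ∂iidMeasure β, 0 < trialTime b := by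
  have hm : ∀ k, MeasurableSet {b : ℕ → Bool | trialTime b = k} := fun k =>
    measurable_trialTime (measurableSet_singleton k)
  have hone : iidMeasure β (⋃ k, {b | trialTime b = k + 1}) = 1 := by
    rw [measure_iUnion (fun i j hij => Set.disjoint_left.2 fun b hb hb' => hij ?_)
      fun k => hm (k + 1)]
    · simp_rw [measure_trialTime_eq_succ hp hβ]
      rw [← measure_iUnion (fun i j hij => Set.disjoint_singleton.2 hij)
        fun k => measurableSet_singleton k, Set.iUnion_of_singleton, measure_univ]
    · have h1 : trialTime b = i + 1 := hb
      have h2 : trialTime b = j + 1 := hb'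
      omega
  have := (prob_compl_eq_zero_iff (MeasurableSet.iUnion fun k => hm (k + 1))).2 hone
  refine measure_mono_null (fun b hb => ?_) this
  simp only [Set.mem_compl_iff, Set.mem_ofPred_eq, Set.mem_iUnion, not_exists] at hb ⊢
  omega

/-- The slots after the first arrival. -/
noncomputable def afterArrival (b : ℕ → Bool) : ℕ → Bool := seqShift (trialTime b) b

lemma measurePreserving_afterArrival {β : Measure Bool} [IsProbabilityMeasure β]
    {p : unitInterval} (hp : p ≠ 0) (hβ : β.real {true} = p) :
    MeasurePreserving afterArrival (iidMeasure β) (iidMeasure β) :=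
  measurePreserving_regeneration β measurable_trialTime (ae_trialTime_pos hp hβ)
    fun _ hk _ _ h h' => trialTime_dependence hk h h'

/-- The number of slots strictly between the arrivals of packets `n` and `n + 1`. -/
noncomputable def arrivalGap (b : ℕ → Bool) (n : ℕ) : ℕ := trialTime (afterArrival^[n + 1] b) - 1

lemma map_trialTime_sub_one {β : Measure Bool} [IsProbabilityMeasure β] {p : unitInterval}
    (hp : p ≠ 0) (hβ : β.real {true} = p) :
    (iidMeasure β).map (fun b => trialTime b - 1) = geometricMeasure p := by
  refine Measure.ext_of_singleton fun k => ?_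
  rw [Measure.map_apply (measurable_trialTime.sub_const 1) (measurableSet_singleton k),
    ← measure_trialTime_eq_succ hp hβ]
  refine measure_congr ?_
  filter_upwards [ae_trialTime_pos hp hβ] with b hb
  refine propext ?_
  change trialTime b - 1 = k ↔ trialTime b = k + 1
  omega

/-- The slots after an arrival are again i.i.d. and independent of the trial time, so successive
trial times are i.i.d. The first of them precedes packet `0` and is dropped by one
measure-preserving shift. -/
lemma map_arrivalGap {β : Measure Bool} [IsProbabilityMeasure β] {p : unitInterval}
    (hp : p ≠ 0) (hβ : β.real {true} = p) :
    Measurable arrivalGap ∧ (iidMeasure β).map arrivalGap = iidMeasure (geometricMeasure p) := by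
  have hθ := measurePreserving_afterArrival hp hβ
  have hC : Measurable (fun b => trialTime b - 1) := measurable_trialTime.sub_const 1
  have hlaw := map_iterate_eq_iidMeasure (P := iidMeasure β) hC hθ fun A D hA hD =>
    measure_regeneration β measurable_trialTime hC (ae_trialTime_pos hp hβ)
      (fun k hk b c h h' => ⟨trialTime_dependence hk h h', by
        rw [trialTime_dependence hk h h', h']⟩) hA hD
  have hm : Measurable (fun (b : ℕ → Bool) (n : ℕ) => trialTime (afterArrival^[n] b) - 1) :=
    measurable_pi_iff.2 fun n => hC.comp (hθ.measurable.iterate n)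
  have hcomp : arrivalGap =
      (fun (b : ℕ → Bool) (n : ℕ) => trialTime (afterArrival^[n] b) - 1) ∘ afterArrival := by
    funext b n
    simp [arrivalGap]
  rw [map_trialTime_sub_one hp hβ] at hlaw
  rw [hcomp]
  refine ⟨hm.comp hθ.measurable, ?_⟩
  rw [← Measure.map_map hm hθ.measurable, hθ.map_eq, hlaw]

lemma genTime_eq_of_count {b : ℕ → Bool} {n t : ℕ} (hb : b t = true)
    (hc : Nat.count (fun i => b i = true) t = n) : genTime b n = t := by
  rw [genTime, ← hc]
  exact Nat.nth_count (p := fun i => b i = true) hb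

/-- Locates packet `n`: `t` carries an arrival and has exactly `n` arrivals before it. The induction
removes the slots up to the first arrival. -/
lemma arrival_sum_trialTime (n : ℕ) {b : ℕ → Bool}
    (hb : ∀ i, 0 < trialTime (afterArrival^[i] b)) :
    ∃ t, ∑ i ∈ Finset.range (n + 1), trialTime (afterArrival^[i] b) = t + 1 ∧ b t = true ∧
      Nat.count (fun i => b i = true) t = n := by
  have hb0 := hb 0
  rw [Function.iterate_zero, id] at hb0
  obtain ⟨k, hk⟩ := Nat.exists_eq_succ_of_ne_zero hb0.ne'
  rw [Nat.succ_eq_add_one] at hk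
  have hk' := (trialTime_eq_succ_iff b k).1 hk
  have hcount : Nat.count (fun i => b i = true) k = 0 := by
    rw [Nat.count_iff_forall_not]
    intro i hi
    simp [hk'.1 i hi]
  induction n generalizing b k with
  | zero =>
    exact ⟨k, by simpa using hk, hk'.2, hcount⟩
  | succ n ih =>
    have hshift : ∀ i, 0 < trialTime (afterArrival^[i] (afterArrival b)) := fun i => by
      rw [← Function.iterate_succ_apply]
      exact hb (i + 1)
    have h0 := hshift 0
    rw [Function.iterate_zero, id] at h0
    obtain ⟨l, hl⟩ := Nat.exists_eq_succ_of_ne_zero h0.ne'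
    rw [Nat.succ_eq_add_one] at hl
    have hl' := (trialTime_eq_succ_iff _ l).1 hl
    obtain ⟨t, ht, htb, htc⟩ := ih hshift h0 l hl hl' (by
      rw [Nat.count_iff_forall_not]
      intro i hi
      simp [hl'.1 i hi])
    refine ⟨k + 1 + t, ?_, ?_, ?_⟩
    · rw [Finset.sum_range_succ']
      simp only [Function.iterate_succ_apply, Function.iterate_zero, id]
      rw [ht, hk]
      ring
    · rw [← htb, afterArrival, hk]
      rfl
    · have hadd := Nat.count_add (p := fun i => b i = true) (k + 1) t
      rw [hadd, Nat.count_succ, hcount, if_pos hk'.2, ← htc, add_comm, zero_add]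
      have : (fun i => afterArrival b i = true) = fun i => b (k + 1 + i) = true := by
        funext i
        rw [afterArrival, hk]
        rfl
      simp only [this]

lemma genTime_succ_eq {b : ℕ → Bool} (hb : ∀ i, 0 < trialTime (afterArrival^[i] b)) (n : ℕ) :
    genTime b (n + 1) = genTime b n + (arrivalGap b n + 1) := by
  obtain ⟨t, ht, htb, htc⟩ := arrival_sum_trialTime n hb
  obtain ⟨t', ht', htb', htc'⟩ := arrival_sum_trialTime (n + 1) hb
  rw [genTime_eq_of_count htb htc, genTime_eq_of_count htb' htc']
  rw [Finset.sum_range_succ, ht] at ht'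
  have := hb (n + 1)
  unfold arrivalGap
  omega

/-! ### From the model to i.i.d. pairs of services and gaps. -/

/-- Two independent i.i.d. sequences form an i.i.d. sequence of pairs. -/
theorem map_prodMk_eq_iidMeasure {Ω α β : Type*} [MeasurableSpace Ω] [MeasurableSpace α]
    [MeasurableSpace β] {P : Measure Ω} [IsProbabilityMeasure P] {X : ℕ → Ω → α} {Y : ℕ → Ω → β}
    {σ : Measure α} {γ : Measure β} [IsProbabilityMeasure σ] [IsProbabilityMeasure γ]
    (hXm : ∀ n, Measurable (X n)) (hYm : ∀ n, Measurable (Y n))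
    (hX : P.map (fun ω n => X n ω) = iidMeasure σ) (hY : P.map (fun ω n => Y n ω) = iidMeasure γ)
    (hXY : IndepFun (fun ω n => X n ω) (fun ω n => Y n ω) P) :
    P.map (fun ω n => (X n ω, Y n ω)) = iidMeasure (σ.prod γ) := by
  have hXm' : Measurable (fun ω n => X n ω) := measurable_pi_iff.2 hXm
  have hYm' : Measurable (fun ω n => Y n ω) := measurable_pi_iff.2 hYm
  have hbox : ∀ (s : Finset ℕ) (A : ℕ → Set α) (B : ℕ → Set β), (∀ i, MeasurableSet (A i)) →
      (∀ i, MeasurableSet (B i)) → P (⋂ i ∈ s, {ω | X i ω ∈ A i ∧ Y i ω ∈ B i}) =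
        ∏ i ∈ s, (σ (A i) * γ (B i)) := by
    intro s A B hA hB
    have hset : (⋂ i ∈ s, {ω | X i ω ∈ A i ∧ Y i ω ∈ B i}) =
        ((fun ω n => X n ω) ⁻¹' (s : Set ℕ).pi A) ∩ ((fun ω n => Y n ω) ⁻¹' (s : Set ℕ).pi B) := by
      ext ω
      simp only [Set.mem_iInter, Set.mem_ofPred_eq, Set.mem_inter_iff, Set.mem_preimage,
        Set.mem_pi, Finset.mem_coe]
      exact ⟨fun h => ⟨fun i hi => (h i hi).1, fun i hi => (h i hi).2⟩,
        fun h i hi => ⟨h.1 i hi, h.2 i hi⟩⟩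
    have hsA : MeasurableSet ((s : Set ℕ).pi A) := .pi s.countable_toSet fun i _ => hA i
    have hsB : MeasurableSet ((s : Set ℕ).pi B) := .pi s.countable_toSet fun i _ => hB i
    rw [hset, hXY.measure_inter_preimage_eq_mul _ _ hsA hsB, ← Measure.map_apply hXm' hsA,
      ← Measure.map_apply hYm' hsB, hX, hY, Measure.infinitePi_pi _ fun i _ => hA i,
      Measure.infinitePi_pi _ fun i _ => hB i, Finset.prod_mul_distrib]
  have hlaw : ∀ n, P.map (fun ω => (X n ω, Y n ω)) = σ.prod γ := by
    intro n
    refine (Measure.prod_eq fun A B hA hB => ?_).symm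
    rw [Measure.map_apply ((hXm n).prodMk (hYm n)) (hA.prod hB)]
    have := hbox {n} (fun _ => A) (fun _ => B) (fun _ => hA) fun _ => hB
    simp only [Finset.mem_singleton, Set.iInter_iInter_eq_left, Finset.prod_singleton] at this
    exact this
  -- Rectangles form a π-system generating the product σ-algebra, and on them independence is the
  -- box formula `hbox`.
  have hind : iIndepFun (fun n ω => (X n ω, Y n ω)) P := by
    rw [iIndepFun]
    refine iIndepSets.iIndep (fun n => ((hXm n).prodMk (hYm n)).comap_le)
      (fun n => {s | ∃ t ∈ Set.image2 (· ×ˢ ·) {A : Set α | MeasurableSet A}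
        {B : Set β | MeasurableSet B}, (fun ω => (X n ω, Y n ω)) ⁻¹' t = s})
      (fun n => isPiSystem_prod.comap _) (fun n => ?_) ?_
    · rw [← generateFrom_prod, MeasurableSpace.comap_generateFrom]
      rfl
    · rw [iIndepSets_iff]
      intro s f hf
      classical
      have hrect : ∀ i, ∃ A B, MeasurableSet A ∧ MeasurableSet B ∧
          (i ∈ s → f i = {ω | X i ω ∈ A ∧ Y i ω ∈ B}) := by
        intro i
        by_cases hi : i ∈ s
        · obtain ⟨_, ⟨A, hA, B, hB, rfl⟩, h⟩ := hf i hi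
          exact ⟨A, B, hA, hB, fun _ => h.symm⟩
        · exact ⟨∅, ∅, .empty, .empty, fun h => absurd h hi⟩
      choose A B hA hB hAB using hrect
      have h₁ : ⋂ i ∈ s, f i = ⋂ i ∈ s, {ω | X i ω ∈ A i ∧ Y i ω ∈ B i} :=
        Set.iInter₂_congr fun i hi => hAB i hi
      rw [h₁, hbox s A B hA hB]
      refine Finset.prod_congr rfl fun i hi => ?_
      have := Measure.map_apply (μ := P) ((hXm i).prodMk (hYm i)) ((hA i).prod (hB i))
      rw [hlaw, Measure.prod_prod] at this
      rw [this, hAB i hi]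
      rfl
  rw [hind.map_fun_eq_infinitePi_map fun n => (hXm n).prodMk (hYm n)]
  simp_rw [hlaw]

/-- The term `x n / n` is a difference of consecutive averages, up to the factor `(n + 1) / n`. -/
lemma tendsto_div_zero_of_average {x : ℕ → ℝ} {l : ℝ}
    (hx : Tendsto (fun n : ℕ => (∑ i ∈ Finset.range n, x i) / n) atTop (nhds l)) :
    Tendsto (fun n : ℕ => x n / n) atTop (nhds 0) := by
  have h := ((hx.comp (tendsto_add_atTop_nat 1)).mul tendsto_succ_div_nat).sub hx
  rw [mul_one, sub_self] at h
  refine h.congr' ?_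
  filter_upwards [eventually_gt_atTop 0] with n hn
  have : (n : ℝ) ≠ 0 := by positivity
  simp only [Function.comp_apply, Finset.sum_range_succ]
  push_cast
  field_simp
  ring

/-- In the stable Ber/G/1 model, the service times and the gaps between the arrivals almost surely
have the expected long-run averages. -/
theorem ae_exists_steps {Ω : Type*} [MeasurableSpace Ω] (P : Measure Ω) [IsProbabilityMeasure P]
    {lam : ℝ} {B : ℕ → Ω → Bool} {S : ℕ → Ω → ℕ} (hmodel : IsBerG1 P lam B S) (hlam : 0 < lam)
    (hsq : Integrable (fun ω => (S 0 ω : ℝ) ^ 2) P)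
    (hstable : lam * ∫ ω, (S 0 ω : ℝ) ∂P < 1) :
    ∃ v c : ℝ,
      v = (lam * ∫ ω, (S 0 ω : ℝ) ^ 2 ∂P - lam * ∫ ω, (S 0 ω : ℝ) ∂P) /
        (2 * (1 - lam * ∫ ω, (S 0 ω : ℝ) ∂P)) ∧
      lam * c = v + (1 - lam) / lam *
        ((1 - lam * ∫ ω, (S 0 ω : ℝ) ∂P) / probGenFun P (S 0) (1 - lam) - 1) ∧
      ∀ᵐ ω ∂P, ∃ u : ℕ → ℕ × ℕ, (∀ n, (u n).1 = S n ω) ∧ (∀ n, 1 ≤ S n ω) ∧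
        (∀ n, genTime (fun t => B t ω) (n + 1) = genTime (fun t => B t ω) n + ((u n).2 + 1)) ∧
        Tendsto (fun n : ℕ => (∑ i ∈ Finset.range n, (waiting u i : ℝ)) / n) atTop (nhds v) ∧
        Tendsto (fun n : ℕ => (∑ i ∈ Finset.range n, (((u i).2 : ℝ) + 1) * waiting u (i + 1)) / n)
          atTop (nhds c) ∧
        Tendsto (fun n : ℕ => (waiting u n : ℝ) ^ 2 / n) atTop (nhds 0) ∧
        Tendsto (fun n : ℕ => (∑ i ∈ Finset.range n, ((u i).1 : ℝ)) / n) atTop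
          (nhds (∫ ω, (S 0 ω : ℝ) ∂P)) ∧
        Tendsto (fun n : ℕ => ((u n).1 : ℝ) ^ 2 / n) atTop (nhds 0) ∧
        Tendsto (fun n : ℕ => (∑ i ∈ Finset.range n, (((u i).2 : ℝ) + 1)) / n) atTop
          (nhds (1 / lam)) ∧
        Tendsto (fun n : ℕ => (∑ i ∈ Finset.range n, (((u i).2 : ℝ) + 1) ^ 2) / (n : ℝ)) atTop
          (nhds ((2 - lam) / lam ^ 2)) ∧
        Tendsto (fun n : ℕ => (∑ i ∈ Finset.range n, (((u i).2 : ℝ) + 1) * (u (i + 1)).1) / n)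
          atTop (nhds (1 / lam * ∫ ω, (S 0 ω : ℝ) ∂P)) := by
  have hlam1 : lam ≤ 1 := by
    rw [← hmodel.prob_arrival 0]
    exact measureReal_le_one
  set p : unitInterval := ⟨lam, hlam.le, hlam1⟩ with hpdef
  have hpl : (p : ℝ) = lam := rfl
  have hp : p ≠ 0 := fun h => hlam.ne' (congrArg Subtype.val h)
  have hBm := hmodel.measurable_arrival
  have hSm := hmodel.measurable_service
  set β := P.map (B 0) with hβdef
  set σ := P.map (S 0) with hσdef
  have : IsProbabilityMeasure β := Measure.isProbabilityMeasure_map (hBm 0).aemeasurable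
  have : IsProbabilityMeasure σ := Measure.isProbabilityMeasure_map (hSm 0).aemeasurable
  have hβt : ∀ t, (P.map (B t)).real {true} = lam := fun t => by
    rw [map_measureReal_apply (hBm t) (measurableSet_singleton _)]
    exact hmodel.prob_arrival t
  have hβ : β.real {true} = p := hβt 0
  have hBlaw : ∀ t, P.map (B t) = β := by
    intro t
    have := Measure.isProbabilityMeasure_map (μ := P) (hBm t).aemeasurable
    have htrue : P.map (B t) {true} = β {true} := by
      rw [← measureReal_eq_measureReal_iff (measure_ne_top _ _) (measure_ne_top _ _), hβt t, hβ]
    refine Measure.ext_of_singleton fun x => ?_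
    cases x
    · have : ({false} : Set Bool) = {true}ᶜ := by ext b; cases b <;> simp
      rw [this, prob_compl_eq_one_sub (measurableSet_singleton _),
        prob_compl_eq_one_sub (measurableSet_singleton _), htrue]
    · exact htrue
  have hB : P.map (fun ω t => B t ω) = iidMeasure β := by
    rw [hmodel.indep_arrival.map_fun_eq_infinitePi_map hBm]
    simp_rw [hBlaw]
  have hSlaw : ∀ n, P.map (S n) = σ := fun n => (hmodel.identDistrib_service n).map_eq
  have hS : P.map (fun ω n => S n ω) = iidMeasure σ := by
    rw [hmodel.indep_service.map_fun_eq_infinitePi_map hSm]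
    simp_rw [hSlaw]
  -- The age area multiplies the gap before packet `n + 1` by the service of packet `n + 1`, so gap
  -- `n` must also be paired with the service times shifted by one.
  have hS' : P.map (fun ω n => S (n + 1) ω) = iidMeasure σ := by
    have hind : iIndepFun (fun n => S (n + 1)) P :=
      hmodel.indep_service.precomp (add_left_injective 1)
    rw [hind.map_fun_eq_infinitePi_map fun n => hSm (n + 1)]
    simp_rw [hSlaw]
  have hBm' : Measurable (fun ω t => B t ω) := measurable_pi_iff.2 hBm
  obtain ⟨hGm, hGlaw⟩ := map_arrivalGap hp hβ
  have hXlaw : P.map (fun ω n => arrivalGap (fun t => B t ω) n) = iidMeasure (geometricMeasure p) := by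
    rw [← hGlaw, ← hB, Measure.map_map hGm hBm']
    rfl
  have hXm : ∀ n, Measurable (fun ω => arrivalGap (fun t => B t ω) n) := fun n =>
    (measurable_pi_apply n).comp (hGm.comp hBm')
  have hindep : IndepFun (fun ω n => S n ω) (fun ω n => arrivalGap (fun t => B t ω) n) P :=
    hmodel.indep_arrival_service.symm.comp measurable_id hGm
  have hindep' : IndepFun (fun ω n => S (n + 1) ω) (fun ω n => arrivalGap (fun t => B t ω) n) P :=
    hmodel.indep_arrival_service.symm.comp
      (φ := fun (s : ℕ → ℕ) n => s (n + 1)) (by fun_prop) hGm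
  have hlaw := map_prodMk_eq_iidMeasure hSm hXm hS hXlaw hindep
  have hlaw' := map_prodMk_eq_iidMeasure (fun n => hSm (n + 1)) hXm hS' hXlaw hindep'
  have hσ : Integrable (fun s : ℕ => (s : ℝ) ^ 2) σ :=
    (integrable_map_measure (measurable_of_countable _).aestronglyMeasurable
      (hSm 0).aemeasurable).2 hsq
  have hσ1 := integrable_cast_of_sq hσ
  have hM : ∫ s : ℕ, (s : ℝ) ∂σ = ∫ ω, (S 0 ω : ℝ) ∂P :=
    integral_map (hSm 0).aemeasurable (measurable_of_countable _).aestronglyMeasurable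
  have hM₂ : ∫ s : ℕ, (s : ℝ) ^ 2 ∂σ = ∫ ω, (S 0 ω : ℝ) ^ 2 ∂P :=
    integral_map (hSm 0).aemeasurable (measurable_of_countable _).aestronglyMeasurable
  have hL : ∫ s : ℕ, (1 - lam) ^ s ∂σ = probGenFun P (S 0) (1 - lam) :=
    integral_map (hSm 0).aemeasurable (measurable_of_countable _).aestronglyMeasurable
  have hpos : ∀ᵐ s ∂σ, 1 ≤ s :=
    (ae_map_iff (hSm 0).aemeasurable (MeasurableSet.of_discrete)).2 hmodel.service_pos
  have hst : ∫ s : ℕ, (s : ℝ) ∂σ < 1 / p := by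
    rw [hpl, lt_div_iff₀ hlam, hM, mul_comm]
    exact hstable
  obtain ⟨v, c, hv, hc, hlim⟩ := tendsto_waiting_averages hp hσ hpos hst
  simp only [hpl] at hv hc
  rw [hM, hM₂] at hv
  rw [hM, hL] at hc
  refine ⟨v, c, hv, hc, ?_⟩
  have hum : Measurable (fun ω n => (S n ω, arrivalGap (fun t => B t ω) n)) :=
    measurable_pi_iff.2 fun n => (hSm n).prodMk (hXm n)
  have hum' : Measurable (fun ω n => (S (n + 1) ω, arrivalGap (fun t => B t ω) n)) :=
    measurable_pi_iff.2 fun n => (hSm (n + 1)).prodMk (hXm n)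
  have hX1 := integrable_geometricMeasure_succ hp
  have hX2 := integrable_geometricMeasure_succ_sq hp
  have a₁ := ae_of_ae_map hum.aemeasurable (hlaw ▸ hlim)
  have a₂ := ae_of_ae_map hum.aemeasurable (hlaw ▸ strong_law_iidMeasure (stepLaw σ p)
    (f := fun z => (z.1 : ℝ)) (measurable_of_countable _) (hσ1.comp_fst _))
  have a₃ := ae_of_ae_map hum.aemeasurable (hlaw ▸ strong_law_iidMeasure (stepLaw σ p)
    (f := fun z => (z.1 : ℝ) ^ 2) (measurable_of_countable _) (hσ.comp_fst _))
  have a₄ := ae_of_ae_map hum.aemeasurable (hlaw ▸ strong_law_iidMeasure (stepLaw σ p)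
    (f := fun z => (z.2 : ℝ) + 1) (measurable_of_countable _) (hX1.comp_snd _))
  have a₅ := ae_of_ae_map hum.aemeasurable (hlaw ▸ strong_law_iidMeasure (stepLaw σ p)
    (f := fun z => ((z.2 : ℝ) + 1) ^ 2) (measurable_of_countable _) (hX2.comp_snd _))
  have a₆ := ae_of_ae_map hum'.aemeasurable (hlaw' ▸ strong_law_iidMeasure (stepLaw σ p)
    (f := fun z => (z.1 : ℝ) * ((z.2 : ℝ) + 1)) (measurable_of_countable _) (hσ1.mul_prod hX1))
  have a₇ : ∀ᵐ ω ∂P, ∀ n, 1 ≤ S n ω := ae_all_iff.2 fun n =>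
    ae_of_ae_map (hSm n).aemeasurable (hSlaw n ▸ hpos)
  have a₈ : ∀ᵐ ω ∂P, ∀ i, 0 < trialTime (afterArrival^[i] fun t => B t ω) := by
    have hθ := measurePreserving_afterArrival hp hβ
    have : ∀ᵐ b ∂iidMeasure β, ∀ i, 0 < trialTime (afterArrival^[i] b) :=
      ae_all_iff.2 fun i => (hθ.iterate i).quasiMeasurePreserving.ae (ae_trialTime_pos hp hβ)
    exact ae_of_ae_map hBm'.aemeasurable (hB ▸ this)
  have i₂ : ∫ z : ℕ × ℕ, (z.1 : ℝ) ∂stepLaw σ p = ∫ ω, (S 0 ω : ℝ) ∂P := by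
    rw [integral_fun_fst (f := fun s : ℕ => (s : ℝ)), probReal_univ, one_smul, hM]
  have i₄ : ∫ z : ℕ × ℕ, ((z.2 : ℝ) + 1) ∂stepLaw σ p = 1 / lam := by
    rw [integral_fun_snd (f := fun x : ℕ => (x : ℝ) + 1), probReal_univ, one_smul,
      integral_geometricMeasure_succ hp]
  have i₅ : ∫ z : ℕ × ℕ, ((z.2 : ℝ) + 1) ^ 2 ∂stepLaw σ p = (2 - lam) / lam ^ 2 := by
    rw [integral_fun_snd (f := fun x : ℕ => ((x : ℝ) + 1) ^ 2), probReal_univ, one_smul,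
      integral_geometricMeasure_succ_sq hp]
  have i₆ : ∫ z : ℕ × ℕ, (z.1 : ℝ) * ((z.2 : ℝ) + 1) ∂stepLaw σ p =
      1 / lam * ∫ ω, (S 0 ω : ℝ) ∂P := by
    rw [integral_prod_mul (fun s : ℕ => (s : ℝ)) (fun x : ℕ => (x : ℝ) + 1), hM,
      integral_geometricMeasure_succ hp, mul_comm]
  rw [i₂] at a₂
  rw [i₄] at a₄
  rw [i₅] at a₅
  rw [i₆] at a₆
  filter_upwards [a₁, a₂, a₃, a₄, a₅, a₆, a₇, a₈] with ω h₁ h₂ h₃ h₄ h₅ h₆ h₇ h₈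
  refine ⟨fun n => (S n ω, arrivalGap (fun t => B t ω) n), fun n => rfl, h₇,
    fun n => genTime_succ_eq h₈ n, h₁.1, h₁.2.1, h₁.2.2, h₂, tendsto_div_zero_of_average h₃, h₄, h₅,
    h₆.congr fun n => ?_⟩
  congr 1
  exact Finset.sum_congr rfl fun i _ => mul_comm _ _

/-! ### The age along a sample path -/

/-- The generation times and the service times of the packets are those given by the sequence `u` of
pairs of a service time and of the number of slots strictly between two arrivals. -/
structure IsStepSequence (arr : ℕ → Bool) (s : ℕ → ℕ) (u : ℕ → ℕ × ℕ) : Prop where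
  service : ∀ n, (u n).1 = s n
  service_pos : ∀ n, 1 ≤ s n
  genTime_succ : ∀ n, genTime arr (n + 1) = genTime arr n + ((u n).2 + 1)

/-- The slot at the end of which the service of packet `n` finishes. -/
noncomputable def finishSlot (d : ℕ) (arr : ℕ → Bool) (s : ℕ → ℕ) (n : ℕ) : ℕ :=
  startSlot d arr s n + s n - 1

section SamplePath

variable {arr : ℕ → Bool} {s : ℕ → ℕ} {u : ℕ → ℕ × ℕ}

/-- The offset `d` delays every service equally and cancels in the recursion, so the waiting times
are the same for both conventions. -/
lemma startSlot_eq (h : IsStepSequence arr s u) (d n : ℕ) :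
    startSlot d arr s n = genTime arr n + d + waiting u n := by
  induction n with
  | zero => rfl
  | succ n ih =>
    rw [startSlot, ih, h.genTime_succ, waiting, lindley, h.service]
    omega

lemma finishSlot_add_one (h : IsStepSequence arr s u) (d n : ℕ) :
    finishSlot d arr s n + 1 = genTime arr n + d + waiting u n + s n := by
  rw [finishSlot, startSlot_eq h]
  have := h.service_pos n
  omega

lemma genTime_le_finishSlot (h : IsStepSequence arr s u) (d n : ℕ) :
    genTime arr n ≤ finishSlot d arr s n := by
  have := finishSlot_add_one h d n
  have := h.service_pos n
  omega

lemma finishSlot_strictMono (h : IsStepSequence arr s u) (d : ℕ) :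
    StrictMono (finishSlot d arr s) := by
  refine strictMono_nat_of_lt_succ fun n => ?_
  have h₁ := finishSlot_add_one h d n
  have h₂ := finishSlot_add_one h d (n + 1)
  have h₃ := h.service_pos (n + 1)
  rw [h.genTime_succ, waiting, lindley, h.service] at h₂
  omega

lemma servedAt_iff (h : IsStepSequence arr s u) (d n t : ℕ) :
    ServedAt d arr s n t ↔ finishSlot d arr s n = t := by
  rw [ServedAt, finishSlot]
  have := h.service_pos n
  omega

lemma age_finishSlot_succ (h : IsStepSequence arr s u) (d a₀ n : ℕ) :
    age d a₀ arr s (finishSlot d arr s n + 1) =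
      min (finishSlot d arr s n - genTime arr n) (age d a₀ arr s (finishSlot d arr s n)) + 1 := by
  classical
  have hex : ∃ i, ServedAt d arr s i (finishSlot d arr s n) := ⟨n, (servedAt_iff h d n _).2 rfl⟩
  rw [age, dif_pos hex]
  have : Nat.find hex = n := by
    have := (servedAt_iff h d _ _).1 (Nat.find_spec hex)
    exact (finishSlot_strictMono h d).injective this
  congr 4

lemma age_succ_of_ne (h : IsStepSequence arr s u) (d a₀ : ℕ) {t : ℕ}
    (ht : ∀ n, finishSlot d arr s n ≠ t) : age d a₀ arr s (t + 1) = age d a₀ arr s t + 1 := by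
  rw [age, dif_neg]
  rintro ⟨n, hn⟩
  exact ht n ((servedAt_iff h d n t).1 hn)

lemma age_of_le_finishSlot_zero (h : IsStepSequence arr s u) (d a₀ : ℕ) {t : ℕ}
    (ht : t ≤ finishSlot d arr s 0) : age d a₀ arr s t = a₀ + t := by
  induction t with
  | zero => rfl
  | succ t ih =>
    rw [age_succ_of_ne h, ih (by omega), add_assoc]
    intro n hn
    have := (finishSlot_strictMono h d).monotone n.zero_le
    omega

lemma finishSlot_ne_of_between (h : IsStepSequence arr s u) (d : ℕ) {n t : ℕ}
    (h₁ : finishSlot d arr s n < t) (h₂ : t < finishSlot d arr s (n + 1)) (m : ℕ) :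
    finishSlot d arr s m ≠ t := by
  rintro rfl
  have h₃ := (finishSlot_strictMono h d).lt_iff_lt.1 h₁
  have h₄ := (finishSlot_strictMono h d).lt_iff_lt.1 h₂
  omega

/-- Between the deliveries of packets `n` and `n + 1`, packet `n` determines the age. -/
lemma age_of_between (h : IsStepSequence arr s u) (d a₀ n : ℕ) {t : ℕ}
    (h₁ : finishSlot d arr s n < t) (h₂ : t ≤ finishSlot d arr s (n + 1)) :
    age d a₀ arr s t = t - genTime arr n := by
  have hext : ∀ n, age d a₀ arr s (finishSlot d arr s n + 1) =
      finishSlot d arr s n + 1 - genTime arr n → ∀ t, finishSlot d arr s n < t →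
      t ≤ finishSlot d arr s (n + 1) → age d a₀ arr s t = t - genTime arr n := by
    intro n h0 t ht
    induction t, ht using Nat.le_induction with
    | base => exact fun _ => h0
    | succ t ht ih =>
      intro ht'
      rw [age_succ_of_ne h d a₀ (finishSlot_ne_of_between h d ht (by omega)), ih (by omega)]
      have := genTime_le_finishSlot h d n
      omega
  refine hext n ?_ t h₁ h₂
  induction n generalizing t with
  | zero =>
    -- At the first delivery the age is `a₀` plus the elapsed time, at least the age of packet `0`.
    -- The minimum therefore erases the initial value.
    rw [age_finishSlot_succ h, age_of_le_finishSlot_zero h d a₀ le_rfl]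
    have := genTime_le_finishSlot h d 0
    omega
  | succ n ih =>
    have hlt : finishSlot d arr s n < finishSlot d arr s (n + 1) :=
    finishSlot_strictMono h d n.lt_succ_self
    -- Packet `n + 1` was generated after packet `n`, so the minimum selects it.
    rw [age_finishSlot_succ h, hext n (ih (Nat.lt_succ_self _) hlt) _ hlt le_rfl]
    have h₃ := genTime_le_finishSlot h d (n + 1)
    have h₄ := h.genTime_succ n
    omega

lemma sum_Icc_finishSlot_succ (h : IsStepSequence arr s u) (d n : ℕ) (f : ℕ → ℝ) :
    ∑ t ∈ Finset.Icc 1 (finishSlot d arr s (n + 1)), f t =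
      ∑ t ∈ Finset.Icc 1 (finishSlot d arr s n), f t +
        ∑ t ∈ Finset.Ioc (finishSlot d arr s n) (finishSlot d arr s (n + 1)), f t :=
  (Finset.sum_Ioc_consecutive f (Nat.zero_le _)
    (finishSlot_strictMono h d n.lt_succ_self).le).symm

/-- Exactly one useful delivery takes place after that of packet `n` and up to that of
packet `n + 1`. -/
lemma sum_useful_between (h : IsStepSequence arr s u) (d a₀ n : ℕ) (f : ℕ → ℝ) :
    ∑ t ∈ Finset.Ioc (finishSlot d arr s n) (finishSlot d arr s (n + 1)),
      (if age d a₀ arr s (t + 1) ≤ age d a₀ arr s t then f t else 0) =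
      f (finishSlot d arr s (n + 1)) := by
  have hlt : finishSlot d arr s n < finishSlot d arr s (n + 1) :=
    finishSlot_strictMono h d n.lt_succ_self
  rw [Finset.sum_eq_single (finishSlot d arr s (n + 1))]
  · rw [if_pos]
    rw [age_finishSlot_succ h, age_of_between h d a₀ n hlt le_rfl]
    have h₃ := genTime_le_finishSlot h d (n + 1)
    have h₄ := h.genTime_succ n
    omega
  · intro t ht hne
    rw [Finset.mem_Ioc] at ht
    rw [if_neg]
    rw [age_succ_of_ne h d a₀ (finishSlot_ne_of_between h d ht.1 (by omega))]
    omega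
  · exact fun hn => absurd (Finset.mem_Ioc.2 ⟨hlt, le_rfl⟩) hn

lemma sum_Ioc_sub (y : ℝ) {a b : ℕ} (hab : a ≤ b) : ∑ t ∈ Finset.Ioc a b, ((t : ℝ) - y) =
    ((b - y) * (b - y + 1) - (a - y) * (a - y + 1)) / 2 := by
  induction b, hab using Nat.le_induction with
  | base => simp
  | succ b hab ih =>
    rw [Finset.sum_Ioc_succ_top hab, ih]
    push_cast
    ring

/-- The number of slots from the arrival of packet `n` to the last slot of its service. -/
def systemTime (d : ℕ) (u : ℕ → ℕ × ℕ) (n : ℕ) : ℝ := d + waiting u n + (u n).1 - 1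

lemma finishSlot_sub_genTime (h : IsStepSequence arr s u) (d n : ℕ) :
    (finishSlot d arr s n : ℝ) - genTime arr n = systemTime d u n := by
  have : (finishSlot d arr s n : ℝ) + 1 = genTime arr n + d + waiting u n + s n := by
    exact_mod_cast finishSlot_add_one h d n
  rw [systemTime, h.service]
  linarith

lemma finishSlot_succ_sub_genTime (h : IsStepSequence arr s u) (d n : ℕ) :
    (finishSlot d arr s (n + 1) : ℝ) - genTime arr n =
      ((u n).2 + 1) + systemTime d u (n + 1) := by
  have : (genTime arr (n + 1) : ℝ) = genTime arr n + ((u n).2 + 1) := by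
    exact_mod_cast h.genTime_succ n
  rw [← finishSlot_sub_genTime h, this]
  ring

lemma age_cast_of_between (h : IsStepSequence arr s u) (d a₀ n : ℕ) {t : ℕ}
    (h₁ : finishSlot d arr s n < t) (h₂ : t ≤ finishSlot d arr s (n + 1)) :
    (age d a₀ arr s t : ℝ) = t - genTime arr n := by
  rw [age_of_between h d a₀ n h₁ h₂, Nat.cast_sub]
  exact (genTime_le_finishSlot h d n).trans h₁.le

/-- Each peak is the time elapsed since the arrival of the previously delivered packet. The slots up
to the first delivery, where `a₀` still matters, form a constant that disappears in the average. -/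
lemma sum_peaks_finishSlot (h : IsStepSequence arr s u) (d a₀ N : ℕ) :
    ∑ t ∈ Finset.Icc 1 (finishSlot d arr s N),
      (if age d a₀ arr s (t + 1) ≤ age d a₀ arr s t then (age d a₀ arr s t : ℝ) else 0) =
    ∑ t ∈ Finset.Icc 1 (finishSlot d arr s 0),
      (if age d a₀ arr s (t + 1) ≤ age d a₀ arr s t then (age d a₀ arr s t : ℝ) else 0) +
      (∑ n ∈ Finset.range N, (((u n).2 : ℝ) + 1) +
        ∑ n ∈ Finset.range N, systemTime d u (n + 1)) := by
  induction N with
  | zero => simp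
  | succ N ih =>
    rw [sum_Icc_finishSlot_succ h, ih, sum_useful_between h d a₀ N fun t => (age d a₀ arr s t : ℝ),
      age_cast_of_between h d a₀ N (finishSlot_strictMono h d N.lt_succ_self) le_rfl,
      finishSlot_succ_sub_genTime h]
    simp only [Finset.sum_range_succ]
    ring

lemma card_peaks_finishSlot (h : IsStepSequence arr s u) (d a₀ N : ℕ) :
    ∑ t ∈ Finset.Icc 1 (finishSlot d arr s N),
      (if age d a₀ arr s (t + 1) ≤ age d a₀ arr s t then (1 : ℝ) else 0) =
    ∑ t ∈ Finset.Icc 1 (finishSlot d arr s 0),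
      (if age d a₀ arr s (t + 1) ≤ age d a₀ arr s t then (1 : ℝ) else 0) + N := by
  induction N with
  | zero => simp
  | succ N ih =>
    rw [sum_Icc_finishSlot_succ h, ih, sum_useful_between h d a₀ N fun _ => (1 : ℝ)]
    push_cast
    ring

/-- A tooth rises from `T n + 1` to `X + T (n + 1)` in unit steps. Expanding its sum and separating
`T (n + 1) * (T (n + 1) + 1) - T n * (T n + 1)` leaves a telescoping boundary term, negligible once
the squared system time is `o(n)`. -/
lemma sum_age_finishSlot (h : IsStepSequence arr s u) (d a₀ N : ℕ) :
    ∑ t ∈ Finset.Icc 1 (finishSlot d arr s N), (age d a₀ arr s t : ℝ) =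
    ∑ t ∈ Finset.Icc 1 (finishSlot d arr s 0), (age d a₀ arr s t : ℝ) +
      ((∑ n ∈ Finset.range N, (((u n).2 : ℝ) + 1) ^ 2) / 2 +
        (∑ n ∈ Finset.range N, (((u n).2 : ℝ) + 1)) / 2 +
        ∑ n ∈ Finset.range N, (((u n).2 : ℝ) + 1) * systemTime d u (n + 1) +
      (systemTime d u N * (systemTime d u N + 1) -
        systemTime d u 0 * (systemTime d u 0 + 1)) / 2) := by
  induction N with
  | zero => simp
  | succ N ih =>
    have hlt := finishSlot_strictMono h d N.lt_succ_self
    have hsum : ∑ t ∈ Finset.Ioc (finishSlot d arr s N) (finishSlot d arr s (N + 1)),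
        (age d a₀ arr s t : ℝ) =
        ∑ t ∈ Finset.Ioc (finishSlot d arr s N) (finishSlot d arr s (N + 1)),
          ((t : ℝ) - genTime arr N) := by
      refine Finset.sum_congr rfl fun t ht => ?_
      rw [Finset.mem_Ioc] at ht
      exact age_cast_of_between h d a₀ N ht.1 ht.2
    rw [sum_Icc_finishSlot_succ h, ih, hsum, sum_Ioc_sub _ hlt.le, finishSlot_succ_sub_genTime h,
      finishSlot_sub_genTime h]
    simp only [Finset.sum_range_succ]
    ring

lemma finishSlot_eq_sum (h : IsStepSequence arr s u) (d N : ℕ) :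
    (finishSlot d arr s N : ℝ) =
      genTime arr 0 + ∑ n ∈ Finset.range N, (((u n).2 : ℝ) + 1) + systemTime d u N := by
  have : (genTime arr N : ℝ) = genTime arr 0 + ∑ n ∈ Finset.range N, (((u n).2 : ℝ) + 1) := by
    induction N with
    | zero => simp
    | succ N ih =>
      rw [h.genTime_succ, Finset.sum_range_succ]
      push_cast
      rw [ih]
      ring
  rw [← this, ← finishSlot_sub_genTime h]
  ring

end SamplePath

/-! ### Passage to the limit and conclusion. -/

lemma tendsto_const_div_nat (C : ℝ) : Tendsto (fun n : ℕ => C / n) atTop (nhds 0) :=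
  tendsto_const_div_atTop_nhds_zero_nat C

/-- If the squares of a sequence are `o(n)`, then so is the sequence. -/
lemma tendsto_div_of_sq {x : ℕ → ℝ} (hx : Tendsto (fun n : ℕ => x n ^ 2 / n) atTop (nhds 0)) :
    Tendsto (fun n : ℕ => x n / n) atTop (nhds 0) := by
  have hb : Tendsto (fun n : ℕ => x n ^ 2 / n + 1 / n) atTop (nhds 0) := by
    simpa using hx.add (tendsto_const_div_nat 1)
  refine squeeze_zero_norm (fun n => ?_) hb
  rw [Real.norm_eq_abs, abs_div, Nat.abs_cast, ← add_div]
  refine div_le_div_of_nonneg_right ?_ n.cast_nonneg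
  rw [← sq_abs]
  nlinarith [sq_nonneg (|x n| - 1), abs_nonneg (x n)]

section Limits

variable {arr : ℕ → Bool} {s : ℕ → ℕ} {u : ℕ → ℕ × ℕ}

lemma tendsto_systemTime_sq (d : ℕ)
    (hW : Tendsto (fun n : ℕ => (waiting u n : ℝ) ^ 2 / n) atTop (nhds 0))
    (hS : Tendsto (fun n : ℕ => ((u n).1 : ℝ) ^ 2 / n) atTop (nhds 0)) :
    Tendsto (fun n : ℕ => systemTime d u n ^ 2 / n) atTop (nhds 0) := by
  have hb : Tendsto (fun n : ℕ => 3 * ((waiting u n : ℝ) ^ 2 / n) + 3 * (((u n).1 : ℝ) ^ 2 / n) +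
      3 * ((d : ℝ) - 1) ^ 2 / n) atTop (nhds 0) := by
    simpa using ((hW.const_mul 3).add (hS.const_mul 3)).add
      (tendsto_const_div_nat (3 * ((d : ℝ) - 1) ^ 2))
  refine squeeze_zero (fun n => by positivity) (fun n => ?_) hb
  have heq : 3 * ((waiting u n : ℝ) ^ 2 / n) + 3 * (((u n).1 : ℝ) ^ 2 / n) +
      3 * ((d : ℝ) - 1) ^ 2 / n = (3 * (waiting u n : ℝ) ^ 2 + 3 * ((u n).1 : ℝ) ^ 2 +
      3 * ((d : ℝ) - 1) ^ 2) / n := by ring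
  rw [heq]
  refine div_le_div_of_nonneg_right ?_ n.cast_nonneg
  unfold systemTime
  nlinarith [sq_nonneg ((waiting u n : ℝ) - (u n).1), sq_nonneg ((waiting u n : ℝ) - (d - 1)),
    sq_nonneg (((u n).1 : ℝ) - (d - 1))]

/-- The peak age and the average age along a sample path with given long-run averages. -/
theorem ages_eq_of_averages (h : IsStepSequence arr s u) (d a₀ : ℕ) {lam v c M : ℝ}
    (hlam : 0 < lam)
    (hWavg : Tendsto (fun n : ℕ => (∑ i ∈ Finset.range n, (waiting u i : ℝ)) / n) atTop (nhds v))
    (hXW : Tendsto (fun n : ℕ =>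
      (∑ i ∈ Finset.range n, (((u i).2 : ℝ) + 1) * waiting u (i + 1)) / n) atTop (nhds c))
    (hW : Tendsto (fun n : ℕ => (waiting u n : ℝ) ^ 2 / n) atTop (nhds 0))
    (hSavg : Tendsto (fun n : ℕ => (∑ i ∈ Finset.range n, ((u i).1 : ℝ)) / n) atTop (nhds M))
    (hS : Tendsto (fun n : ℕ => ((u n).1 : ℝ) ^ 2 / n) atTop (nhds 0))
    (hX : Tendsto (fun n : ℕ => (∑ i ∈ Finset.range n, (((u i).2 : ℝ) + 1)) / n) atTop
      (nhds (1 / lam)))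
    (hX2 : Tendsto (fun n : ℕ => (∑ i ∈ Finset.range n, (((u i).2 : ℝ) + 1) ^ 2) / (n : ℝ)) atTop
      (nhds ((2 - lam) / lam ^ 2)))
    (hXS : Tendsto (fun n : ℕ =>
      (∑ i ∈ Finset.range n, (((u i).2 : ℝ) + 1) * (u (i + 1)).1) / n) atTop
      (nhds (1 / lam * M))) :
    peakAge (age d a₀ arr s) = ((1 / lam + M + v + d - 1 : ℝ) : EReal) ∧
      averageAge (age d a₀ arr s) = ((1 / lam + M + lam * c + d - 1 : ℝ) : EReal) := by
  have hD2 := tendsto_systemTime_sq d hW hS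
  have hD := tendsto_div_of_sq hD2
  have hlam' : 0 < 1 / lam := by positivity
  -- The system time is `o(N)`, so deliveries occur asymptotically at the arrival rate.
  have hfin : Tendsto (fun N : ℕ => (finishSlot d arr s N : ℝ) / N) atTop (nhds (1 / lam)) := by
    have := ((tendsto_const_div_nat (genTime arr 0 : ℝ)).add hX).add hD
    rw [zero_add, add_zero] at this
    refine this.congr fun N => ?_
    rw [finishSlot_eq_sum h]
    ring
  have hmono : ∀ f : ℕ → ℝ, (∀ t, 0 ≤ f t) → Monotone fun T => ∑ t ∈ Finset.Icc 1 T, f t :=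
    fun f hf m n hmn => Finset.sum_le_sum_of_subset_of_nonneg
      (Finset.Icc_subset_Icc le_rfl hmn) fun _ _ _ => hf _
  have hDavg : Tendsto (fun N : ℕ => (∑ n ∈ Finset.range N, systemTime d u (n + 1)) / N) atTop
      (nhds ((d : ℝ) - 1 + v + M)) := by
    have h1 : Tendsto (fun N : ℕ => ((d : ℝ) - 1) * ((N : ℝ) / N)) atTop (nhds (d - 1)) := by
      refine tendsto_const_nhds.congr' ?_
      filter_upwards [eventually_gt_atTop 0] with N hN
      have : (N : ℝ) ≠ 0 := by positivity
      rw [div_self this, mul_one]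
    have := (((h1.add hWavg).add hSavg).add hD).sub (tendsto_const_div_nat (systemTime d u 0))
    rw [add_zero, sub_zero] at this
    refine this.congr fun N => ?_
    have hs : ∑ n ∈ Finset.range N, systemTime d u (n + 1) =
        ∑ n ∈ Finset.range N, systemTime d u n + systemTime d u N - systemTime d u 0 := by
      rw [← Finset.sum_range_succ, Finset.sum_range_succ']
      ring
    have hs' : ∑ n ∈ Finset.range N, systemTime d u n = (d - 1) * N +
        ∑ n ∈ Finset.range N, (waiting u n : ℝ) + ∑ n ∈ Finset.range N, ((u n).1 : ℝ) := by
      have : ∀ n, systemTime d u n = (d - 1 : ℝ) + (waiting u n + (u n).1) := fun n => by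
        unfold systemTime
        ring
      simp_rw [this]
      rw [Finset.sum_add_distrib, Finset.sum_add_distrib]
      simp
      ring
    rw [hs, hs']
    ring
  constructor
  -- All summands are nonnegative, so limits along the delivery slots extend to all `T`. The upper
  -- limits in the definitions of the ages are therefore limits.
  · have hnum := tendsto_div_of_monotone_of_tendsto_comp
      (hmono (fun t => if age d a₀ arr s (t + 1) ≤ age d a₀ arr s t then (age d a₀ arr s t : ℝ)
        else 0) fun t => by positivity) hlam' hfin (α := 1 / lam + (d - 1 + v + M)) (by
        have := (tendsto_const_div_nat (∑ t ∈ Finset.Icc 1 (finishSlot d arr s 0),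
          (if age d a₀ arr s (t + 1) ≤ age d a₀ arr s t then (age d a₀ arr s t : ℝ)
            else 0))).add (hX.add hDavg)
        rw [zero_add] at this
        refine this.congr fun N => ?_
        rw [sum_peaks_finishSlot h d a₀ N]
        ring)
    have hden := tendsto_div_of_monotone_of_tendsto_comp
      (hmono (fun t => if age d a₀ arr s (t + 1) ≤ age d a₀ arr s t then (1 : ℝ) else 0)
        fun t => by positivity) hlam' hfin (α := 1) (by
        have := (tendsto_const_div_nat (∑ t ∈ Finset.Icc 1 (finishSlot d arr s 0),
          (if age d a₀ arr s (t + 1) ≤ age d a₀ arr s t then (1 : ℝ) else 0))).add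
          (tendsto_const_nhds (x := (1 : ℝ)))
        rw [zero_add] at this
        refine this.congr' ?_
        filter_upwards [eventually_gt_atTop 0] with N hN
        have : (N : ℝ) ≠ 0 := by positivity
        rw [card_peaks_finishSlot h d a₀ N, add_div, div_self this])
    refine Tendsto.limsup_eq (EReal.tendsto_coe.2 ?_)
    have hval : (1 / lam + (d - 1 + v + M)) / (1 / lam) / (1 / (1 / lam)) =
        1 / lam + M + v + d - 1 := by
      field_simp
      ring
    rw [← hval]
    refine (hnum.div hden (by positivity)).congr' ?_
    filter_upwards [eventually_gt_atTop 0] with T hT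
    have : (T : ℝ) ≠ 0 := by positivity
    rw [Pi.div_apply, div_div_div_cancel_right₀ this]
  · have hXD : Tendsto (fun N : ℕ => (∑ n ∈ Finset.range N,
        (((u n).2 : ℝ) + 1) * systemTime d u (n + 1)) / N) atTop
        (nhds (c + 1 / lam * M + (d - 1) * (1 / lam))) := by
      refine ((hXW.add hXS).add (hX.const_mul ((d : ℝ) - 1))).congr fun N => ?_
      have : ∀ n, (((u n).2 : ℝ) + 1) * systemTime d u (n + 1) =
          (((u n).2 : ℝ) + 1) * waiting u (n + 1) + (((u n).2 : ℝ) + 1) * (u (n + 1)).1 +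
            (d - 1) * (((u n).2 : ℝ) + 1) := fun n => by
        unfold systemTime
        ring
      have hs := Finset.sum_congr (rfl : Finset.range N = Finset.range N) fun n _ => this n
      rw [Finset.sum_add_distrib, Finset.sum_add_distrib, ← Finset.mul_sum] at hs
      rw [hs]
      ring
    have harea := tendsto_div_of_monotone_of_tendsto_comp
      (hmono (fun t => (age d a₀ arr s t : ℝ)) fun t => Nat.cast_nonneg _) hlam' hfin
      (α := (2 - lam) / lam ^ 2 / 2 + 1 / lam / 2 + (c + 1 / lam * M + (d - 1) * (1 / lam))) (by
        have := ((tendsto_const_div_nat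
          (∑ t ∈ Finset.Icc 1 (finishSlot d arr s 0), (age d a₀ arr s t : ℝ))).add
          (((hX2.div_const 2).add (hX.div_const 2)).add hXD)).add
          (((hD2.add hD).sub (tendsto_const_div_nat
            (systemTime d u 0 * (systemTime d u 0 + 1)))).div_const 2)
        simp only [zero_add, add_zero, sub_zero, zero_div] at this
        refine this.congr fun N => ?_
        rw [sum_age_finishSlot h d a₀ N]
        ring)
    refine Tendsto.limsup_eq (EReal.tendsto_coe.2 ?_)
    have hval : ((2 - lam) / lam ^ 2 / 2 + 1 / lam / 2 +
        (c + 1 / lam * M + (d - 1) * (1 / lam))) / (1 / lam) =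
        1 / lam + M + lam * c + d - 1 := by
      field_simp
      ring
    rw [← hval]
    refine harea.congr fun T => ?_
    rw [one_div, inv_mul_eq_div]

end Limits

theorem theorem1 {Ω : Type*} [MeasurableSpace Ω] (P : Measure Ω) [IsProbabilityMeasure P]
    (lam μ ρ : ℝ) (B : ℕ → Ω → Bool) (S : ℕ → Ω → ℕ) (a₀ : Ω → ℕ)
    (hmodel : IsBerG1 P lam B S)
    (hlam : 0 < lam)
    (hmean : ∫ ω, (S 0 ω : ℝ) ∂P = 1 / μ)
    (hsq : Integrable (fun ω => (S 0 ω : ℝ) ^ 2) P)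
    (hρ : ρ = lam / μ) (hstable : ρ < 1) :
    ∀ᵐ ω ∂P,
      -- Service can begin in the slot after the arrival slot.
      (peakAge (age 1 (a₀ ω) (fun t => B t ω) (fun n => S n ω)) =
          ((1 / lam + 1 / μ
            + (lam * (∫ ω', (S 0 ω' : ℝ) ^ 2 ∂P) - ρ) / (2 * (1 - ρ)) : ℝ) : EReal) ∧
        averageAge (age 1 (a₀ ω) (fun t => B t ω) (fun n => S n ω)) =
          ((1 + 1 / μ + (1 - lam) * (1 - ρ) / (lam * probGenFun P (S 0) (1 - lam))
            + (lam * (∫ ω', (S 0 ω' : ℝ) ^ 2 ∂P) - ρ) / (2 * (1 - ρ)) : ℝ) : EReal)) ∧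
      -- Service can begin in the arrival slot itself: both values are smaller by one slot.
      (peakAge (age 0 (a₀ ω) (fun t => B t ω) (fun n => S n ω)) =
          ((1 / lam + 1 / μ
            + (lam * (∫ ω', (S 0 ω' : ℝ) ^ 2 ∂P) - ρ) / (2 * (1 - ρ)) - 1 : ℝ) : EReal) ∧
        averageAge (age 0 (a₀ ω) (fun t => B t ω) (fun n => S n ω)) =
          ((1 + 1 / μ + (1 - lam) * (1 - ρ) / (lam * probGenFun P (S 0) (1 - lam))
            + (lam * (∫ ω', (S 0 ω' : ℝ) ^ 2 ∂P) - ρ) / (2 * (1 - ρ)) - 1 : ℝ) : EReal)) := by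
  have hM1 : 1 ≤ 1 / μ := by
    rw [← hmean]
    have hint : Integrable (fun ω => (S 0 ω : ℝ)) P := by
      refine (hsq.add (integrable_const (1 : ℝ))).mono'
        ((measurable_of_countable (fun k : ℕ => (k : ℝ))).comp
          (hmodel.measurable_service 0)).aestronglyMeasurable (Eventually.of_forall fun ω => ?_)
      simp only [Real.norm_natCast, Pi.add_apply]
      nlinarith [sq_nonneg ((S 0 ω : ℝ) - 1), (S 0 ω).cast_nonneg (α := ℝ)]
    have := integral_mono_ae (integrable_const (1 : ℝ)) hint
      (hmodel.service_pos.mono fun ω hω => Nat.one_le_cast.2 hω)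
    simpa using this
  have hρ' : ρ = lam * (1 / μ) := by rw [hρ]; ring
  obtain ⟨v, c, hv, hc, hae⟩ := ae_exists_steps P hmodel hlam hsq (by
    rw [hmean, ← hρ']
    exact hstable)
  rw [hmean, ← hρ'] at hv hc
  filter_upwards [hae] with ω ⟨u, h₁, h₂, h₃, hW, hXW, hW2, hS, hS2, hX, hX2, hXS⟩
  rw [hmean] at hS hXS
  have hu : IsStepSequence (fun t => B t ω) (fun n => S n ω) u := ⟨h₁, h₂, h₃⟩
  -- The sequence `u` and its averages do not involve `d`, so a single null set serves both
  -- conventions.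
  have hages := fun d => ages_eq_of_averages hu d (a₀ ω) hlam hW hXW hW2 hS hS2 hX hX2 hXS
  -- The leading `1` arises as `1 / lam - (1 - lam) / lam`.
  have havg : 1 / lam + 1 / μ + lam * c = 1 + 1 / μ +
      (1 - lam) * (1 - ρ) / (lam * probGenFun P (S 0) (1 - lam)) +
      (lam * (∫ ω', (S 0 ω' : ℝ) ^ 2 ∂P) - ρ) / (2 * (1 - ρ)) := by
    rw [hc, hv, mul_comm lam (probGenFun _ _ _), ← div_div ((1 - lam) * (1 - ρ))]
    field_simp
    ring
  refine ⟨⟨?_, ?_⟩, ?_, ?_⟩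
  · rw [(hages 1).1, hv]
    congr 1
    push_cast
    ring
  · rw [(hages 1).2, havg]
    congr 1
    push_cast
    ring
  · rw [(hages 0).1, hv]
    congr 1
    push_cast
    ring
  · rw [(hages 0).2, havg]
    congr 1
    push_cast
    ring
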